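/- **Theorem 4.4.** Let $\mathcal H_0$ be a complex Hilbert space with inner product $\langle\cdot,\cdot\rangle$ and let $A$ be a positive definite selfadjoint operator in $\mathcal H_0$ (that is, $\langle Au,u\rangle\ge\alpha\|u\|^2$ on $\mathcal D(A)$ for some $\alpha>0$). Let $\mathcal G_0$ be a Hilbert space with the same elements as $\mathcal H_0$ and an equivalent norm, with inner product $(\cdot,\cdot)_0$, and let $M$ be a positive definite selfadjoint operator in $\mathcal G_0$ with $M^{-1}$ compact. Let $\mu_1\le\mu_2\le\cdots$ be all eigenvalues of $M$, counted according to multiplicity, with corresponding $\mathcal G_0$-orthonormal eigenvectors $q_1,q_2,\dots$, and let $\lambda_1\le\lambda_2\le\cdots$ be all eigenvalues of $A$, counted according to (finite) multiplicity, with corresponding $\mathcal H_0$-orthonormal eigenvectors $u_1,u_2,\dots$. For real $s$ write $\langle x,y\rangle_s=\langle A^sx,A^sy\rangle$ and $\|x\|_s=\|A^sx\|$ for $x,y\in\mathcal D(A^s)$, and equip $\mathcal D(A^s)$ and $\mathcal D(M^s)$, $s>0$, with the norms $\|A^s\cdot\|$ and $|M^s\cdot|_0$. For each $n$ let $\Lambda_1^{(n,0)}\le\dots\le\Lambda_n^{(n,0)}$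 be the dual harmonic Ritz values with trial vectors $q_1,\dots,q_n$, i.e. the eigenvalues of the generalized matrix eigenvalue problem $$\big[\langle q_i,q_k\rangle\big]_{i,k=1}^n\,\mathbf x=\Lambda\,\big[\langle A^{-1}q_i,q_k\rangle\big]_{i,k=1}^n\,\mathbf x ,$$ and let $u_1^{(n,0)},\dots,u_n^{(n,0)}\in\operatorname{span}\{q_1,\dots,q_n\}$ be any corresponding Ritz vectors, orthonormalized by $\langle u_i^{(n,0)},u_k^{(n,0)}\rangle_{-1/2}=\delta_{ik}$. Let $\tau>0$, assume that $\mathcal D(M^\tau)=\mathcal D(A^\tau)$ with equivalent norms, and that $\mathcal D(M^{2\tau})\subset\mathcal D(A^{2\tau})$ with continuous inclusion. Let $\ell$ be such that $\lambda_\ell<\lambda_{\ell+1}$, let $\sigma\ge\tau$, and suppose that for each $j=1,\dots,\ell$ $$\frac{\sum_{k=n+1}^\infty\mu_k^{4\tau}|(u_j,q_k)_0|^2}{\sum_{k=n+1}^\infty\mu_k^{2\tau}|(u_j,q_k)_0|^2}=O\big(\mu_{n+1}^{2\tau}\big)\quad\text{as }n\to\infty$$ (the sums being taken in $[0,\infty]$,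 and the ratio being read as $0$ if both sums vanish), and $u_j\in\mathcal D(M^\sigma)$. Then for each $j=1,\dots,\ell$ there exist, for every $n$, eigenvectors $u_{j,n}$ of $A$ in the $\lambda_j$-eigenspace with $\|u_{j,n}\|_{-1/2}=1$, such that $u_{j,n}-u_j^{(n,0)}\in\mathcal D(A^\tau)$ for all $n\ge j$ and $$\|u_{j,n}-u_j^{(n,0)}\|_\tau=o\big(\mu_{n+1}^{\tau-\sigma}\big)\quad\text{as }n\to\infty .$$ In particular, if $\lambda_j$ is a simple eigenvalue, there are scalars $\omega_n$ with $|\omega_n|=1$ such that $\lambda_j^{1/2}u_j-\omega_nu_j^{(n,0)}\in\mathcal D(A^\tau)$ for all $n\ge j$ and $$\|\lambda_j^{1/2}u_j-\omega_n u_j^{(n,0)}\|_\tau=o\big(\mu_{n+1}^{\tau-\sigma}\big)\quad\text{as }n\to\infty ;$$ here $\lambda_j^{1/2}u_j$ is $u_j$ renormalized so that its $\|\cdot\|_{-1/2}$-norm is $1$. -/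

import Mathlib

open Filter Asymptotics
open scoped ENNReal NNReal Topology

noncomputable section

namespace FractionalRitz

variable {H : Type*} [NormedAddCommGroup H] [InnerProductSpace ℂ H] [CompleteSpace H]
variable {G : Type*} [NormedAddCommGroup G] [InnerProductSpace ℂ G] [CompleteSpace G]

/-- A (possibly unbounded) operator is positive definite selfadjoint: `A = A†`
(which for Mathlib's adjoint includes density of the domain) and `⟨A x, x⟩ ≥ α ‖x‖²` on `D(A)`
for some `α > 0`. -/
structure IsPosDefSelfAdjoint (A : H →ₗ.[ℂ] H) : Prop where
  selfAdjoint : IsSelfAdjoint A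
  posDef : ∃ α : ℝ, 0 < α ∧ ∀ x : A.domain, α * ‖(x : H)‖ ^ 2 ≤ (inner ℂ (A x) (x : H)).re

/-- `T` is the bounded, everywhere defined, two-sided inverse of `A : D(A) → H`. -/
structure IsBoundedInverse (A : H →ₗ.[ℂ] H) (T : H →L[ℂ] H) : Prop where
  right_inv : ∀ y : H, ∃ h : T y ∈ A.domain, A ⟨T y, h⟩ = y
  left_inv : ∀ x : A.domain, T (A x) = x

/-- A positive definite selfadjoint operator has a bounded inverse. -/
theorem IsPosDefSelfAdjoint.exists_inverse {A : H →ₗ.[ℂ] H} (hA : IsPosDefSelfAdjoint A) :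
    ∃ T : H →L[ℂ] H, IsBoundedInverse A T := by
  obtain ⟨α, hα, hpos⟩ := hA.posDef
  have hbd : ∀ x : A.domain, α * ‖(x : H)‖ ≤ ‖A x‖ := by
    intro x
    rcases eq_or_lt_of_le (norm_nonneg (x : H)) with h0 | h0
    · rw [← h0]; simp
    · have h1 := hpos x
      have h2 : (inner ℂ (A x) (x : H)).re ≤ ‖A x‖ * ‖(x : H)‖ :=
        (Complex.re_le_norm _).trans (norm_inner_le_norm _ _)
      have h3 : α * ‖(x : H)‖ * ‖(x : H)‖ ≤ ‖A x‖ * ‖(x : H)‖ := by nlinarith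
      exact le_of_mul_le_mul_right h3 h0
  have hinj : ∀ x : A.domain, A x = 0 → x = 0 := by
    intro x hx
    have h1 := hbd x
    rw [hx, norm_zero] at h1
    have h2 : ‖(x : H)‖ = 0 := by nlinarith [norm_nonneg (x : H)]
    exact Subtype.ext (norm_eq_zero.1 h2)
  have hdense := hA.selfAdjoint.dense_domain
  have hsymm : ∀ x y : A.domain, inner ℂ (A x) (y : H) = inner ℂ (x : H) (A y) := by
    have h := LinearPMap.adjoint_isFormalAdjoint hdense
    rw [LinearPMap.isSelfAdjoint_def.1 hA.selfAdjoint] at h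
    exact h
  let R : Submodule ℂ H := LinearMap.range A.toFun
  have hRclosed : IsClosed (R : Set H) := by
    rw [← isSeqClosed_iff_isClosed]
    intro y z hy hz
    choose x hx using hy
    have hcy : CauchySeq y := hz.cauchySeq
    have hcx : CauchySeq fun n => (x n : H) := by
      rw [Metric.cauchySeq_iff] at hcy ⊢
      intro ε hε
      obtain ⟨N, hN⟩ := hcy (α * ε) (by positivity)
      refine ⟨N, fun m hm n hn => ?_⟩
      have h1 := hN m hm n hn
      have h2 := hbd (x m - x n)
      have h3 : A (x m - x n) = y m - y n := by
        rw [LinearPMap.map_sub]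
        exact congrArg₂ (· - ·) (hx m) (hx n)
      rw [h3, ← dist_eq_norm] at h2
      have h4 : ‖((x m - x n : A.domain) : H)‖ = dist (x m : H) (x n) := by
        rw [dist_eq_norm]; rfl
      rw [h4] at h2
      exact lt_of_mul_lt_mul_left (h2.trans_lt h1) hα.le
    obtain ⟨w, hw⟩ := cauchySeq_tendsto_of_complete hcx
    have hcl : IsClosed (A.graph : Set (H × H)) := hA.selfAdjoint.isClosed
    have hmem : ((w, z) : H × H) ∈ (A.graph : Set (H × H)) := by
      refine hcl.mem_of_tendsto (hw.prodMk_nhds hz) (Eventually.of_forall fun n => ?_)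
      exact (LinearPMap.mem_graph_iff A).2 ⟨x n, rfl, hx n⟩
    obtain ⟨v, _, hv⟩ := (LinearPMap.mem_graph_iff A).1 hmem
    exact ⟨v, hv⟩
  have hRtop : R = ⊤ := by
    have : CompleteSpace R := hRclosed.completeSpace_coe
    rw [← Submodule.orthogonal_eq_bot_iff, Submodule.eq_bot_iff]
    intro y hy
    have h0 : ∀ x : A.domain, inner ℂ (0 : H) (x : H) = inner ℂ y (A x) := by
      intro x
      rw [inner_zero_left]
      exact ((Submodule.mem_orthogonal' _ _).1 hy (A x) ⟨x, rfl⟩).symm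
    have hmem := LinearPMap.mem_adjoint_domain_of_exists (T := A) y ⟨0, h0⟩
    have happ := LinearPMap.adjoint_apply_eq hdense ⟨y, hmem⟩ h0
    have hle : A.adjoint ≤ A := le_of_eq (LinearPMap.isSelfAdjoint_def.1 hA.selfAdjoint)
    have hy' : y ∈ A.domain := hle.1 hmem
    have h2 : A ⟨y, hy'⟩ = 0 := by
      rw [← happ]
      exact (hle.2 rfl).symm
    exact congrArg Subtype.val (hinj _ h2)
  have hsurj : ∀ y : H, ∃ x : A.domain, A x = y := by
    intro y
    have : y ∈ R := hRtop ▸ Submodule.mem_top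
    exact this
  choose g hg using hsurj
  have huniq : ∀ x x' : A.domain, A x = A x' → x = x' := by
    intro x x' h
    have := hinj (x - x') (by rw [LinearPMap.map_sub, h, sub_self])
    exact sub_eq_zero.1 this
  let L : H →ₗ[ℂ] H :=
    { toFun := fun y => (g y : H)
      map_add' := fun y z => by
        have : g (y + z) = g y + g z := huniq _ _ (by rw [LinearPMap.map_add, hg, hg, hg])
        rw [this]; rfl
      map_smul' := fun c y => by
        have : g (c • y) = c • g y := huniq _ _ (by rw [LinearPMap.map_smul, hg, hg])
        rw [this]; rfl }
  refine ⟨L.mkContinuous α⁻¹ fun y => ?_, ?_, ?_⟩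
  · have h1 := hbd (g y)
    rw [hg] at h1
    rw [inv_mul_eq_div, le_div_iff₀ hα, mul_comm]
    exact h1
  · intro y
    exact ⟨(g y).2, hg y⟩
  · intro x
    exact congrArg Subtype.val (huniq (g (A x)) x (hg _))

open scoped Classical in
/-- The bounded inverse `A⁻¹` of a positive definite selfadjoint operator (and `0` for an operator
that has no bounded inverse). -/
def boundedInverse (A : H →ₗ.[ℂ] H) : H →L[ℂ] H :=
  if h : ∃ T : H →L[ℂ] H, IsBoundedInverse A T then h.choose else 0

theorem IsPosDefSelfAdjoint.isBoundedInverse {A : H →ₗ.[ℂ] H} (hA : IsPosDefSelfAdjoint A) :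
    IsBoundedInverse A (boundedInverse A) := by
  have h := hA.exists_inverse
  rw [boundedInverse, dif_pos h]
  exact h.choose_spec

/-- The real power `A ^ s` of a positive definite selfadjoint operator, as an operator with its
natural domain. With `T = A⁻¹` (bounded, positive, injective) and `T ^ r`, `r ≥ 0`, given by the
continuous functional calculus, `A ^ s` is the inverse of `T ^ s`, with domain the range of
`T ^ s`, for `s > 0`; and it is the everywhere defined operator `T ^ (-s)` for `s ≤ 0`. -/
def fracPow (A : H →ₗ.[ℂ] H) (s : ℝ) : H →ₗ.[ℂ] H :=
  if 0 < s then
    ((((boundedInverse A) ^ s : H →L[ℂ] H) : H →ₗ[ℂ] H).toPMap ⊤).inverse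
  else
    (((boundedInverse A) ^ (-s) : H →L[ℂ] H) : H →ₗ[ℂ] H).toPMap ⊤

open scoped Classical in
/-- The inner product `⟨x, y⟩_s = ⟨A^s x, A^s y⟩` for `x, y ∈ D(A^s)`. -/
def scaleInner (A : H →ₗ.[ℂ] H) (s : ℝ) (x y : H) : ℂ :=
  if h : x ∈ (fracPow A s).domain ∧ y ∈ (fracPow A s).domain then
    inner ℂ (fracPow A s ⟨x, h.1⟩) (fracPow A s ⟨y, h.2⟩)
  else 0

open scoped Classical in
/-- The norm `‖x‖_s = ‖A^s x‖` for `x ∈ D(A^s)`. -/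
def scaleNorm (A : H →ₗ.[ℂ] H) (s : ℝ) (x : H) : ℝ :=
  if h : x ∈ (fracPow A s).domain then ‖fracPow A s ⟨x, h⟩‖ else 0

/-- `x ∈ D(A)` and `A x = c x`. -/
def InEigenspace (A : H →ₗ.[ℂ] H) (c : ℝ) (x : H) : Prop :=
  ∃ h : x ∈ A.domain, A ⟨x, h⟩ = (c : ℂ) • x

/-- `ν 0 ≤ ν 1 ≤ …` are all the eigenvalues of `A`, counted according to (finite) multiplicity,
with corresponding orthonormal eigenvectors `e 0, e 1, …`. -/
structure IsEigenEnumeration (A : H →ₗ.[ℂ] H) (ν : ℕ → ℝ) (e : ℕ → H) : Prop where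
  monotone : Monotone ν
  orthonormal : Orthonormal ℂ e
  eigen : ∀ k, InEigenspace A (ν k) (e k)
  exhaustive : ∀ (c : ℝ) (x : H), InEigenspace A c x →
    x ∈ Submodule.span ℂ (e '' {k | ν k = c})

/-- `D(M^s) ⊂ D(A^s)` with continuous inclusion, the elements of the two underlying spaces being
identified by `ι`. -/
def ContinuouslyContained (M : G →ₗ.[ℂ] G) (A : H →ₗ.[ℂ] H) (ι : G ≃L[ℂ] H) (s : ℝ) : Prop :=
  ∃ C : ℝ, ∀ x : G, x ∈ (fracPow M s).domain →
    ι x ∈ (fracPow A s).domain ∧ scaleNorm A s (ι x) ≤ C * scaleNorm M s x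

/-- The Rayleigh-Ritz method for `T = A⁻¹` in `D(A^t)` with trial vectors `w 0, …, w (n-1)`:
the Ritz values `Λ` (increasing) and Ritz vectors `r` come from the generalized matrix eigenvalue
problem `[⟨w_i, w_j⟩_t] x = Λ [⟨T w_i, w_j⟩_t] x`, and the Ritz vectors are
orthonormal with respect to `⟨·, ·⟩_{t - 1/2}`. The parameter `t = 0` is the dual harmonic
Ritz method. -/
structure IsRitzSystem (A : H →ₗ.[ℂ] H) (t : ℝ) (w : ℕ → H) (n : ℕ)
    (Λ : Fin n → ℝ) (r : Fin n → H) : Prop where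
  trial_mem : ∀ i : Fin n, w i ∈ (fracPow A t).domain
  monotone : Monotone Λ
  eigen : ∀ j, ∃ x : Fin n → ℂ, r j = ∑ i : Fin n, x i • w i ∧
    (Matrix.of fun i k : Fin n => scaleInner A t (w i) (w k)).mulVec x =
      (Λ j : ℂ) •
        (Matrix.of fun i k : Fin n =>
          scaleInner A t (boundedInverse A (w i)) (w k)).mulVec x
  orthonormal : ∀ i j, scaleInner A (t - 1 / 2) (r i) (r j) = if i = j then 1 else 0

/-- The tail `∑_{k ≥ n} μ_k^p |(v, q_k)|²`, with value in `[0, ∞]`. -/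
def weightedTail (μ : ℕ → ℝ) (q : ℕ → G) (p : ℝ) (v : G) (n : ℕ) : ℝ≥0∞ :=
  ∑' k : ℕ, ENNReal.ofReal (μ (n + k) ^ p * ‖inner ℂ (q (n + k)) v‖ ^ 2)

end FractionalRitz

end

/-!
Write `T = A⁻¹`, let `W n` be the span of the first `n` trial vectors, regarded as
elements of `H`, and `Q n` the orthogonal projection onto it.

*Compactness.* Since `D(A^τ) ⊂ D(M^τ)` and Fourier sums in the eigenvectors of `M` approximate
`D(M^τ)` at the rate `μ n ^ (-τ)`, the operators `(1 - Q n) T ^ τ` tend to zero in norm. By the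
`C*`-identity the same holds for `T ^ (τ / 2 ^ m)`, hence for `T`
(`tendsto_opNorm_sub_starProjection`). So `T` is compact, the eigenvectors of `A` form a Hilbert
basis of `H`, and `ε n = ‖(1 - Q n) T‖` is a null sequence.

*The Ritz problem in `H`.* The dual harmonic Ritz vectors `r` solve `Q n T r = Λ⁻¹ r` in `W n`:
they come from the Galerkin method for the bounded operator `T` in the inner product of `H`. The
variational principle gives `1 / λ_j - 2 ε n ≤ 1 / Λ_j ≤ 1 / λ_j`
(`IsGalerkinSystem.sub_le_inv`, `IsGalerkinSystem.inv_le`). Testing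
`T r = Λ⁻¹ r + (1 - Q n) T r` with the eigenvectors for the other eigenvalues bounds, in the norm
of `H`, the distance from `r` to its component in the `λ_j`-eigenspace by a multiple of the
distance from that eigenspace to `W n` (`norm_sub_eigencomponent_le`). As the eigenvectors lie in
`D(M^σ)`, that distance is `o(μ n ^ (-σ))`.

*Passage to `D(A^τ)`.* The norm of `D(A^τ)` is bounded by that of `D(M^τ)`. In the coordinates of
the eigenvectors of `M`, the first `n` modes of the error cost a factor `μ n ^ τ` (inverse
estimate), and from the `n`-th mode on the Ritz vector has no component, so that only the tail of
the eigenvector is left, which is `o(μ n ^ (τ - σ))` (`IsEigenEnumeration.norm_le_of_tail_eq`).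
-/

noncomputable section

namespace FractionalRitz

/-! ### Real powers of positive operators -/

section Powers

theorem aeval_apply_of_eigen {E : Type*} [NormedAddCommGroup E] [InnerProductSpace ℂ E]
    {T : E →L[ℂ] E} {c : ℝ} {x : E} (hx : T x = (c : ℂ) • x) (p : Polynomial ℝ) :
    (Polynomial.aeval T p) x = ((p.eval c : ℝ) : ℂ) • x := by
  induction p using Polynomial.induction_on' with
  | add p q hp hq =>
    rw [map_add, add_apply, hp, hq, Polynomial.eval_add, Complex.ofReal_add,
      add_smul]
  | monomial n a =>
    have hpow : (T ^ n) x = ((c ^ n : ℝ) : ℂ) • x := by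
      induction n with
      | zero => simp
      | succ n ih =>
        rw [pow_succ', mul_apply_eq_comp, ih, map_smul, hx, smul_smul, pow_succ]
        push_cast; rfl
    rw [Polynomial.aeval_monomial, Polynomial.eval_monomial, mul_apply_eq_comp, hpow,
      Algebra.algebraMap_eq_smul_one, smul_apply, Complex.ofReal_mul, mul_smul]
    rfl

variable {E : Type*} [NormedAddCommGroup E] [InnerProductSpace ℂ E] [CompleteSpace E]
  {T : E →L[ℂ] E}

theorem rpow_add_of_nonneg (hT : 0 ≤ T) {a b : ℝ} (ha : 0 ≤ a) (hb : 0 ≤ b) :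
    T ^ (a + b) = T ^ a * T ^ b := by
  rw [CFC.rpow_eq_cfc_real, CFC.rpow_eq_cfc_real, CFC.rpow_eq_cfc_real,
    ← cfc_mul (fun x : ℝ => x ^ a) (fun x : ℝ => x ^ b) T
      (Real.continuous_rpow_const ha).continuousOn (Real.continuous_rpow_const hb).continuousOn]
  exact cfc_congr fun x hx => Real.rpow_add_of_nonneg (spectrum_nonneg_of_nonneg hT hx) ha hb

theorem rpow_add_apply (hT : 0 ≤ T) {a b : ℝ} (ha : 0 ≤ a) (hb : 0 ≤ b) (x : E) :
    (T ^ (a + b) : E →L[ℂ] E) x = (T ^ a : E →L[ℂ] E) ((T ^ b : E →L[ℂ] E) x) := by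
  rw [rpow_add_of_nonneg hT ha hb]; rfl

theorem inner_rpow_left (T : E →L[ℂ] E) (s : ℝ) (x y : E) :
    inner ℂ ((T ^ s : E →L[ℂ] E) x) y = inner ℂ x ((T ^ s : E →L[ℂ] E) y) :=
  ((ContinuousLinearMap.nonneg_iff_isPositive _).1
    (CFC.rpow_nonneg (a := T) (y := s))).isSymmetric x y

theorem rpow_injective (hT : 0 ≤ T) (hinj : Function.Injective T) {s : ℝ} (hs : 0 ≤ s) :
    Function.Injective (T ^ s : E →L[ℂ] E) := by
  obtain ⟨m, hm⟩ := exists_nat_ge s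
  have h1 : (T ^ m : E →L[ℂ] E) = T ^ ((m : ℝ) - s) * T ^ s := by
    rw [← rpow_add_of_nonneg hT (by linarith) hs, sub_add_cancel, CFC.rpow_natCast T m hT]
  have h2 : Function.Injective (T ^ m : E →L[ℂ] E) := by
    rw [FunLike.coe_pow_eq_iterate]
    exact hinj.iterate m
  rw [h1] at h2
  exact Function.Injective.of_comp (f := (T ^ ((m : ℝ) - s) : E →L[ℂ] E)) h2

/-- The continuous functional calculus acts on eigenvectors by evaluating the function at the
eigenvalue; this holds for polynomials, and hence for their uniform limits. -/
theorem rpow_apply_of_eigen (hT : 0 ≤ T) {c : ℝ} (hc : 0 ≤ c) {x : E} (hx : T x = (c : ℂ) • x)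
    {s : ℝ} (hs : 0 ≤ s) : (T ^ s : E →L[ℂ] E) x = ((c ^ s : ℝ) : ℂ) • x := by
  have hself : IsSelfAdjoint T := IsSelfAdjoint.of_nonneg hT
  rw [← sub_eq_zero, ← norm_eq_zero]
  refine le_antisymm (le_of_forall_pos_le_add fun ε hε => ?_) (norm_nonneg _)
  set η : ℝ := ε / (2 * (‖x‖ + 1)) with hη
  have hηpos : 0 < η := by positivity
  set R : ℝ := max (‖T‖ * ‖(1 : E →L[ℂ] E)‖) c with hR
  obtain ⟨p, hp⟩ := exists_polynomial_near_of_continuousOn 0 R (fun y => y ^ s)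
    (Real.continuous_rpow_const hs).continuousOn η hηpos
  have h1 : ‖(T ^ s : E →L[ℂ] E) - Polynomial.aeval T p‖ ≤ η := by
    rw [CFC.rpow_eq_cfc_real, ← cfc_polynomial p T, ← cfc_sub (fun x : ℝ => x ^ s) p.eval T
      (Real.continuous_rpow_const hs).continuousOn p.continuous.continuousOn]
    refine norm_cfc_le hηpos.le fun y hy => ?_
    have hy0 := spectrum_nonneg_of_nonneg hT hy
    have hyT : y ≤ R := (le_abs_self y).trans
      ((spectrum.norm_le_norm_mul_of_mem hy).trans (le_max_left _ _))
    rw [norm_sub_rev]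
    exact (hp y ⟨hy0, hyT⟩).le
  have h2 := hp c ⟨hc, le_max_right _ _⟩
  have h3 : (T ^ s : E →L[ℂ] E) x - ((c ^ s : ℝ) : ℂ) • x =
      ((T ^ s : E →L[ℂ] E) - Polynomial.aeval T p) x + ((p.eval c - c ^ s : ℝ) : ℂ) • x := by
    rw [sub_apply, aeval_apply_of_eigen hx]
    push_cast
    rw [sub_smul]; abel
  rw [h3]
  have h4 : ‖((T ^ s : E →L[ℂ] E) - Polynomial.aeval T p) x‖ ≤ η * ‖x‖ :=
    ContinuousLinearMap.le_of_opNorm_le _ h1 x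
  have h5 : ‖((p.eval c - c ^ s : ℝ) : ℂ) • x‖ ≤ η * ‖x‖ := by
    rw [norm_smul, Complex.norm_real]
    exact mul_le_mul_of_nonneg_right h2.le (norm_nonneg _)
  have h6 : η * (2 * (‖x‖ + 1)) = ε := by
    rw [hη]; field_simp
  nlinarith [norm_add_le (((T ^ s : E →L[ℂ] E) - Polynomial.aeval T p) x)
    (((p.eval c - c ^ s : ℝ) : ℂ) • x)]

end Powers

/-! ### The scale of spaces of a positive definite selfadjoint operator -/

section Scale

variable {E : Type*} [NormedAddCommGroup E] [InnerProductSpace ℂ E] [CompleteSpace E]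
  {A : E →ₗ.[ℂ] E}

theorem IsPosDefSelfAdjoint.inverse_injective (hA : IsPosDefSelfAdjoint A) :
    Function.Injective (boundedInverse A) := by
  intro x y h
  obtain ⟨h1, h2⟩ := hA.isBoundedInverse.right_inv x
  obtain ⟨h3, h4⟩ := hA.isBoundedInverse.right_inv y
  rw [← h2, ← h4]
  congr 1
  exact Subtype.ext h

theorem IsPosDefSelfAdjoint.inverse_nonneg (hA : IsPosDefSelfAdjoint A) :
    0 ≤ boundedInverse A := by
  have hdense := hA.selfAdjoint.dense_domain
  have hsymm : ∀ x y : A.domain, inner ℂ (A x) (y : E) = inner ℂ (x : E) (A y) := by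
    have h := LinearPMap.adjoint_isFormalAdjoint hdense
    rw [LinearPMap.isSelfAdjoint_def.1 hA.selfAdjoint] at h
    exact h
  rw [ContinuousLinearMap.nonneg_iff_isPositive]
  constructor
  · intro x y
    obtain ⟨h1, h2⟩ := hA.isBoundedInverse.right_inv x
    obtain ⟨h3, h4⟩ := hA.isBoundedInverse.right_inv y
    have := hsymm ⟨_, h1⟩ ⟨_, h3⟩
    rw [h2, h4] at this
    exact this.symm
  · intro x
    obtain ⟨h1, h2⟩ := hA.isBoundedInverse.right_inv x
    obtain ⟨α, hα, hpos⟩ := hA.posDef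
    have := hpos ⟨_, h1⟩
    rw [h2] at this
    rw [ContinuousLinearMap.reApplyInnerSelf_apply, ← inner_conj_symm, RCLike.conj_re]
    exact le_trans (by positivity) this

/-- An eigenvector equation for `A` is one for `A⁻¹` with the reciprocal eigenvalue. -/
theorem IsPosDefSelfAdjoint.inEigenspace_iff (hA : IsPosDefSelfAdjoint A) {c : ℝ} (hc : c ≠ 0)
    (x : E) : InEigenspace A c x ↔ boundedInverse A x = ((c⁻¹ : ℝ) : ℂ) • x := by
  have hc' : (c : ℂ) ≠ 0 := by exact_mod_cast hc
  constructor
  · rintro ⟨h, hx⟩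
    have h1 := hA.isBoundedInverse.left_inv ⟨x, h⟩
    rw [hx, map_smul] at h1
    rw [Complex.ofReal_inv, ← inv_smul_smul₀ hc' (boundedInverse A x), h1]
  · intro h
    obtain ⟨h1, h2⟩ := hA.isBoundedInverse.right_inv ((c : ℂ) • x)
    have h3 : boundedInverse A ((c : ℂ) • x) = x := by
      rw [map_smul, h, Complex.ofReal_inv, smul_inv_smul₀ hc']
    refine ⟨h3 ▸ h1, ?_⟩
    refine Eq.trans ?_ h2
    congr 1
    exact Subtype.ext h3.symm

theorem IsPosDefSelfAdjoint.eigenvalue_pos (hA : IsPosDefSelfAdjoint A) {c : ℝ} {x : E}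
    (hx : x ≠ 0) (h : InEigenspace A c x) : 0 < c := by
  obtain ⟨α, hα, hpos⟩ := hA.posDef
  obtain ⟨h1, h2⟩ := h
  have h3 := hpos ⟨x, h1⟩
  rw [h2, inner_smul_left, inner_self_eq_norm_sq_to_K] at h3
  simp only [Complex.conj_ofReal] at h3
  have h4 : 0 < ‖x‖ ^ 2 := by have := norm_pos_iff.2 hx; positivity
  have h5 : ((c : ℂ) * (‖x‖ : ℂ) ^ 2).re = c * ‖x‖ ^ 2 := by
    rw [← Complex.ofReal_pow, ← Complex.ofReal_mul, Complex.ofReal_re]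
  have h6 : α * ‖x‖ ^ 2 ≤ c * ‖x‖ ^ 2 := by rw [← h5]; exact h3
  nlinarith

theorem ker_toPMap_rpow (hA : IsPosDefSelfAdjoint A) {s : ℝ} (hs : 0 ≤ s) :
    LinearMap.ker ((((boundedInverse A) ^ s : E →L[ℂ] E) : E →ₗ[ℂ] E).toPMap ⊤).toFun = ⊥ := by
  rw [LinearMap.ker_eq_bot]
  intro x y h
  exact Subtype.ext (rpow_injective hA.inverse_nonneg hA.inverse_injective hs h)

theorem mem_fracPow_domain {s : ℝ} (hs : 0 < s) {x : E} :
    x ∈ (fracPow A s).domain ↔ ∃ y, ((boundedInverse A) ^ s : E →L[ℂ] E) y = x := by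
  rw [fracPow, if_pos hs, LinearPMap.inverse_domain]
  constructor
  · rintro ⟨y, hy⟩
    exact ⟨y, hy⟩
  · rintro ⟨y, hy⟩
    exact ⟨⟨y, trivial⟩, hy⟩

theorem rpow_mem_domain {s : ℝ} (hs : 0 < s) (y : E) :
    ((boundedInverse A) ^ s : E →L[ℂ] E) y ∈ (fracPow A s).domain :=
  (mem_fracPow_domain hs).2 ⟨y, rfl⟩

theorem fracPow_apply_of_eq (hA : IsPosDefSelfAdjoint A) {s : ℝ} (hs : 0 < s) {y : E}
    (x : (fracPow A s).domain) (hxy : ((boundedInverse A) ^ s : E →L[ℂ] E) y = x) :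
    fracPow A s x = y := by
  have key : ∀ (B : E →ₗ.[ℂ] E)
      (_ : B = ((((boundedInverse A) ^ s : E →L[ℂ] E) : E →ₗ[ℂ] E).toPMap ⊤).inverse)
      (x : B.domain), ((boundedInverse A) ^ s : E →L[ℂ] E) y = x → B x = y := by
    rintro B rfl x hx
    exact LinearPMap.inverse_apply_eq (ker_toPMap_rpow hA hs.le) (x := ⟨y, trivial⟩) hx
  exact key _ (by rw [fracPow, if_pos hs]) x hxy

theorem scaleNorm_rpow_apply (hA : IsPosDefSelfAdjoint A) {s : ℝ} (hs : 0 < s) (y : E) :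
    scaleNorm A s (((boundedInverse A) ^ s : E →L[ℂ] E) y) = ‖y‖ := by
  rw [scaleNorm, dif_pos (rpow_mem_domain hs y), fracPow_apply_of_eq hA hs _ rfl]

theorem mem_fracPow_domain_of_nonpos {s : ℝ} (hs : s ≤ 0) (x : E) :
    x ∈ (fracPow A s).domain := by
  rw [fracPow, if_neg hs.not_gt]; trivial

theorem fracPow_apply_of_nonpos {s : ℝ} (hs : s ≤ 0) (x : (fracPow A s).domain) :
    fracPow A s x = ((boundedInverse A) ^ (-s) : E →L[ℂ] E) x := by
  have key : ∀ (B : E →ₗ.[ℂ] E)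
      (_ : B = (((boundedInverse A) ^ (-s) : E →L[ℂ] E) : E →ₗ[ℂ] E).toPMap ⊤)
      (x : B.domain), B x = ((boundedInverse A) ^ (-s) : E →L[ℂ] E) x := by
    rintro B rfl x
    rfl
  exact key _ (by rw [fracPow, if_neg hs.not_gt]) x

theorem scaleNorm_of_nonpos {s : ℝ} (hs : s ≤ 0) (x : E) :
    scaleNorm A s x = ‖((boundedInverse A) ^ (-s) : E →L[ℂ] E) x‖ := by
  rw [scaleNorm, dif_pos (mem_fracPow_domain_of_nonpos hs x), fracPow_apply_of_nonpos hs]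

theorem scaleInner_of_nonpos {s : ℝ} (hs : s ≤ 0) (x y : E) :
    scaleInner A s x y = inner ℂ (((boundedInverse A) ^ (-s) : E →L[ℂ] E) x)
      (((boundedInverse A) ^ (-s) : E →L[ℂ] E) y) := by
  rw [scaleInner, dif_pos ⟨mem_fracPow_domain_of_nonpos hs x, mem_fracPow_domain_of_nonpos hs y⟩,
    fracPow_apply_of_nonpos hs, fracPow_apply_of_nonpos hs]

theorem scaleInner_zero (hA : IsPosDefSelfAdjoint A) (x y : E) :
    scaleInner A 0 x y = inner ℂ x y := by
  rw [scaleInner_of_nonpos le_rfl, neg_zero, CFC.rpow_zero _ hA.inverse_nonneg]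
  rfl

theorem scaleInner_neg_half (hA : IsPosDefSelfAdjoint A) (x y : E) :
    scaleInner A (0 - 1 / 2) x y = inner ℂ x (boundedInverse A y) := by
  have h : (boundedInverse A : E →L[ℂ] E) = (boundedInverse A) ^ (1 / 2 + 1 / 2 : ℝ) := by
    rw [add_halves, CFC.rpow_one _ hA.inverse_nonneg]
  rw [scaleInner_of_nonpos (by norm_num), inner_rpow_left, zero_sub, neg_neg]
  conv_rhs => rw [h, rpow_add_apply hA.inverse_nonneg (by norm_num) (by norm_num)]

theorem scaleNorm_smul (s : ℝ) (c : ℂ) (x : E)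
    (hx : x ∈ (fracPow A s).domain) : scaleNorm A s (c • x) = ‖c‖ * scaleNorm A s x := by
  rw [scaleNorm, dif_pos ((fracPow A s).domain.smul_mem c hx), scaleNorm, dif_pos hx, ← norm_smul,
    ← LinearPMap.map_smul]
  rfl

end Scale

/-! ### Fourier sums -/

section Bases

variable {E : Type*} [NormedAddCommGroup E] [InnerProductSpace ℂ E]

theorem hasSum_norm_inner_sq (b : HilbertBasis ℕ ℂ E) (x : E) :
    HasSum (fun k => ‖(inner ℂ (b k) x : ℂ)‖ ^ 2) (‖x‖ ^ 2) := by
  have h := (b.hasSum_inner_mul_inner x x).mapL Complex.reCLM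
  have h2 : (inner ℂ x x : ℂ).re = ‖x‖ ^ 2 := by
    rw [inner_self_eq_norm_sq_to_K]
    rw [← RCLike.ofReal_pow]
    exact Complex.ofReal_re (‖x‖ ^ 2)
  simp only [Complex.reCLM_apply, h2] at h
  convert h using 2 with k
  rw [← inner_conj_symm x (b k), ← Complex.normSq_eq_conj_mul_self, Complex.ofReal_re,
    Complex.normSq_eq_norm_sq]

theorem norm_le_mul_of_coord_le (b : HilbertBasis ℕ ℂ E) {C : ℝ} (hC : 0 ≤ C) {x y : E}
    (h : ∀ k, ‖(inner ℂ (b k) x : ℂ)‖ ≤ C * ‖(inner ℂ (b k) y : ℂ)‖) : ‖x‖ ≤ C * ‖y‖ := by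
  have h1 : ‖x‖ ^ 2 ≤ C ^ 2 * ‖y‖ ^ 2 := by
    refine hasSum_le (fun k => ?_) (hasSum_norm_inner_sq b x)
      ((hasSum_norm_inner_sq b y).mul_left (C ^ 2))
    rw [← mul_pow]
    exact pow_le_pow_left₀ (norm_nonneg _) (h k) 2
  rw [← mul_pow] at h1
  exact le_of_sq_le_sq h1 (by positivity)

/-- The orthogonal projection onto the span of the first `n` vectors of an orthonormal sequence,
as a finite Fourier sum. -/
def fourierSum (q : ℕ → E) (n : ℕ) (x : E) : E :=
  ∑ i ∈ Finset.range n, (inner ℂ (q i) x : ℂ) • q i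

theorem inner_sub_fourierSum {q : ℕ → E} (hq : Orthonormal ℂ q) (n k : ℕ) (x : E) :
    inner ℂ (q k) (x - fourierSum q n x) = if k < n then 0 else (inner ℂ (q k) x : ℂ) := by
  rw [fourierSum, inner_sub_right]
  split_ifs with h
  · rw [hq.inner_right_sum (fun i => (inner ℂ (q i) x : ℂ)) (Finset.mem_range.2 h), sub_self]
  · rw [inner_sum, Finset.sum_eq_zero, sub_zero]
    intro i hi
    rw [inner_smul_right, hq.2 (by rintro rfl; exact h (Finset.mem_range.1 hi)), mul_zero]

theorem tendsto_sub_fourierSum (b : HilbertBasis ℕ ℂ E) (x : E) :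
    Tendsto (fun n => ‖x - fourierSum b n x‖) atTop (𝓝 0) := by
  have h := (b.hasSum_repr x).tendsto_sum_nat
  simp only [b.repr_apply_apply] at h
  simpa [fourierSum] using (tendsto_const_nhds (x := x)).sub h |>.norm

theorem norm_sub_fourierSum_le (b : HilbertBasis ℕ ℂ E) (n : ℕ) (x : E) :
    ‖x - fourierSum b n x‖ ≤ ‖x‖ := by
  rw [← one_mul ‖x‖]
  refine norm_le_mul_of_coord_le b zero_le_one fun k => ?_
  rw [inner_sub_fourierSum b.orthonormal, one_mul]
  split_ifs
  · simp
  · exact le_rfl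

theorem fourierSum_sum_smul (q : ℕ → E) (n : ℕ) (F : Finset ℕ) (c : ℕ → ℂ) (y : ℕ → E) :
    fourierSum q n (∑ k ∈ F, c k • y k) = ∑ k ∈ F, c k • fourierSum q n (y k) := by
  simp only [fourierSum, inner_sum, inner_smul_right, Finset.sum_smul, Finset.smul_sum, mul_smul]
  exact Finset.sum_comm

theorem norm_sum_sub_fourierSum_le (q : ℕ → E) (n : ℕ) (F : Finset ℕ) {c : ℕ → ℂ} {a : ℝ}
    (hc : ∀ k ∈ F, ‖c k‖ ≤ a) (y : ℕ → E) :
    ‖∑ k ∈ F, c k • y k - fourierSum q n (∑ k ∈ F, c k • y k)‖ ≤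
      a * ∑ k ∈ F, ‖y k - fourierSum q n (y k)‖ := by
  rw [fourierSum_sum_smul, ← Finset.sum_sub_distrib, Finset.mul_sum]
  refine (norm_sum_le _ _).trans (Finset.sum_le_sum fun k hk => ?_)
  rw [← smul_sub, norm_smul]
  exact mul_le_mul_of_nonneg_right (hc k hk) (norm_nonneg _)

end Bases

/-! ### Eigenvectors of an operator with compact inverse -/

section Eigenbases

variable {E : Type*} [NormedAddCommGroup E] [InnerProductSpace ℂ E] [CompleteSpace E]
  {A : E →ₗ.[ℂ] E} {ν : ℕ → ℝ} {e : ℕ → E}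

theorem IsEigenEnumeration.pos (hA : IsPosDefSelfAdjoint A) (he : IsEigenEnumeration A ν e)
    (k : ℕ) : 0 < ν k :=
  hA.eigenvalue_pos (he.orthonormal.ne_zero k) (he.eigen k)

theorem IsEigenEnumeration.inverse_apply (hA : IsPosDefSelfAdjoint A)
    (he : IsEigenEnumeration A ν e) (k : ℕ) :
    boundedInverse A (e k) = (((ν k)⁻¹ : ℝ) : ℂ) • e k :=
  (hA.inEigenspace_iff (he.pos hA k).ne' _).1 (he.eigen k)

theorem IsEigenEnumeration.rpow_apply (hA : IsPosDefSelfAdjoint A)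
    (he : IsEigenEnumeration A ν e) {s : ℝ} (hs : 0 ≤ s) (k : ℕ) :
    ((boundedInverse A) ^ s : E →L[ℂ] E) (e k) = ((ν k ^ (-s) : ℝ) : ℂ) • e k := by
  rw [rpow_apply_of_eigen hA.inverse_nonneg (inv_nonneg.2 (he.pos hA k).le)
    (he.inverse_apply hA k) hs, Real.inv_rpow (he.pos hA k).le, Real.rpow_neg (he.pos hA k).le]

theorem IsEigenEnumeration.inner_rpow (hA : IsPosDefSelfAdjoint A)
    (he : IsEigenEnumeration A ν e) {s : ℝ} (hs : 0 ≤ s) (k : ℕ) (x : E) :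
    inner ℂ (e k) (((boundedInverse A) ^ s : E →L[ℂ] E) x) =
      ((ν k ^ (-s) : ℝ) : ℂ) * inner ℂ (e k) x := by
  rw [← inner_rpow_left, he.rpow_apply hA hs, inner_smul_left, Complex.conj_ofReal]

/-- Eigenvalues enumerated with multiplicity tend to infinity if the inverse is compact: a
compact operator cannot keep infinitely many orthonormal vectors a fixed distance apart. -/
theorem IsEigenEnumeration.tendsto_atTop (hA : IsPosDefSelfAdjoint A)
    (hc : IsCompactOperator (boundedInverse A)) (he : IsEigenEnumeration A ν e) :
    Tendsto ν atTop atTop := by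
  obtain ⟨K, hK, hKs⟩ := IsCompactOperator.image_closedBall_subset_compact
    (f := (boundedInverse A : E →ₗ[ℂ] E)) hc 1
  have hmem : ∀ k, boundedInverse A (e k) ∈ K := fun k =>
    hKs ⟨e k, by simp [he.orthonormal.1 k], rfl⟩
  obtain ⟨z, -, φ, hφ, hz⟩ := hK.tendsto_subseq hmem
  have h1 : Tendsto (fun n => ‖boundedInverse A (e (φ n)) - boundedInverse A (e (φ (n + 1)))‖)
      atTop (𝓝 0) := by
    simpa using (hz.sub (hz.comp (tendsto_add_atTop_nat 1))).norm
  have h2 : Tendsto (fun n => (ν (φ n))⁻¹) atTop (𝓝 0) := by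
    refine squeeze_zero (fun n => inv_nonneg.2 (he.pos hA _).le) (fun n => ?_) h1
    have hne : φ n ≠ φ (n + 1) := (hφ n.lt_succ_self).ne
    have h3 : (inner ℂ (e (φ n)) (boundedInverse A (e (φ n)) -
        boundedInverse A (e (φ (n + 1)))) : ℂ) = (((ν (φ n))⁻¹ : ℝ) : ℂ) := by
      rw [he.inverse_apply hA, he.inverse_apply hA, inner_sub_right, inner_smul_right,
        inner_smul_right, he.orthonormal.2 hne, inner_self_eq_norm_sq_to_K,
        he.orthonormal.1 (φ n)]
      simp
    have h4 := norm_inner_le_norm (𝕜 := ℂ) (e (φ n)) (boundedInverse A (e (φ n)) -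
        boundedInverse A (e (φ (n + 1))))
    rw [h3, he.orthonormal.1, one_mul, Complex.norm_real, Real.norm_eq_abs,
      abs_of_pos (inv_pos.2 (he.pos hA _))] at h4
    exact h4
  have h5 : Tendsto (fun n => (ν (φ n))⁻¹) atTop (𝓝[>] 0) :=
    tendsto_nhdsWithin_iff.2 ⟨h2, Eventually.of_forall fun n => inv_pos.2 (he.pos hA _)⟩
  have h6 := h5.inv_tendsto_nhdsGT_zero
  refine tendsto_atTop_of_monotone_of_subseq he.monotone (φ := φ) ?_ (l := atTop)
  convert h6 using 1
  ext n
  simp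

theorem IsEigenEnumeration.orthogonal_eq_bot (hA : IsPosDefSelfAdjoint A)
    (hc : IsCompactOperator (boundedInverse A)) (he : IsEigenEnumeration A ν e) :
    (Submodule.span ℂ (Set.range e))ᗮ = ⊥ := by
  have hsymm := ((ContinuousLinearMap.nonneg_iff_isPositive _).1 hA.inverse_nonneg).isSymmetric
  have hbot := ContinuousLinearMap.orthogonalComplement_iSup_eigenspaces_eq_bot hc hsymm
  rw [eq_bot_iff, ← hbot]
  refine Submodule.orthogonal_le (iSup_le fun c x hx => ?_)
  rw [Module.End.mem_eigenspace_iff] at hx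
  by_cases hx0 : x = 0
  · rw [hx0]; exact zero_mem _
  have hconj := hsymm.conj_eigenvalue_eq_self
    (Module.End.hasEigenvalue_of_hasEigenvector ⟨Module.End.mem_eigenspace_iff.2 hx, hx0⟩)
  obtain ⟨d, rfl⟩ := RCLike.conj_eq_iff_real.1 hconj
  have hd : d ≠ 0 := by
    rintro rfl
    refine hx0 (hA.inverse_injective ?_)
    rw [map_zero]
    simpa using hx
  have h1 : InEigenspace A d⁻¹ x := by
    rw [hA.inEigenspace_iff (inv_ne_zero hd), inv_inv]
    exact hx
  exact Submodule.span_mono (Set.image_subset_range _ _) (he.exhaustive _ _ h1)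

/-- The eigenvectors of an operator with compact inverse, as a Hilbert basis. -/
def IsEigenEnumeration.basis (hA : IsPosDefSelfAdjoint A)
    (hc : IsCompactOperator (boundedInverse A)) (he : IsEigenEnumeration A ν e) :
    HilbertBasis ℕ ℂ E :=
  HilbertBasis.mkOfOrthogonalEqBot he.orthonormal (he.orthogonal_eq_bot hA hc)

theorem IsEigenEnumeration.coe_basis (hA : IsPosDefSelfAdjoint A)
    (hc : IsCompactOperator (boundedInverse A)) (he : IsEigenEnumeration A ν e) :
    (he.basis hA hc : ℕ → E) = e :=
  HilbertBasis.coe_mkOfOrthogonalEqBot _ _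

/-- Vectors in `D(A^s)` are approximated by their Fourier sums at the rate `ν n ^ (-s)`. -/
theorem IsEigenEnumeration.norm_rpow_sub_fourierSum_le (hA : IsPosDefSelfAdjoint A)
    (hc : IsCompactOperator (boundedInverse A)) (he : IsEigenEnumeration A ν e) {s : ℝ}
    (hs : 0 ≤ s) (n : ℕ) (y : E) :
    ‖((boundedInverse A) ^ s : E →L[ℂ] E) y -
        fourierSum e n (((boundedInverse A) ^ s : E →L[ℂ] E) y)‖ ≤
      ν n ^ (-s) * ‖y - fourierSum e n y‖ := by
  refine norm_le_mul_of_coord_le (he.basis hA hc) (Real.rpow_nonneg (he.pos hA n).le _)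
    fun k => ?_
  rw [he.coe_basis, inner_sub_fourierSum he.orthonormal, inner_sub_fourierSum he.orthonormal]
  split_ifs with h
  · simp
  · rw [he.inner_rpow hA hs, norm_mul, Complex.norm_real, Real.norm_eq_abs,
      abs_of_nonneg (Real.rpow_nonneg (he.pos hA k).le _)]
    exact mul_le_mul_of_nonneg_right (Real.rpow_le_rpow_of_nonpos (he.pos hA n)
      (he.monotone (not_lt.1 h)) (neg_nonpos.2 hs)) (norm_nonneg _)

end Eigenbases

/-! ### Trial spaces -/

section TrialSpaces

variable {H : Type*} [NormedAddCommGroup H] [InnerProductSpace ℂ H]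
variable {G : Type*} [NormedAddCommGroup G] [InnerProductSpace ℂ G]

/-- The span of the first `n` trial vectors. -/
def trialSpace (w : ℕ → H) (n : ℕ) : Submodule ℂ H :=
  Submodule.span ℂ (Set.range fun i : Fin n => w i)

instance (w : ℕ → H) (n : ℕ) : FiniteDimensional ℂ (trialSpace w n) :=
  FiniteDimensional.span_of_finite ℂ (Set.finite_range _)

theorem norm_sub_starProjection_le {W : Submodule ℂ H} [W.HasOrthogonalProjection] (x : H) {y : H}
    (hy : y ∈ W) : ‖x - W.starProjection x‖ ≤ ‖x - y‖ := by
  rw [Submodule.starProjection_minimal]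
  exact ciInf_le ⟨0, by rintro _ ⟨z, rfl⟩; exact norm_nonneg _⟩ (⟨y, hy⟩ : W)

theorem norm_map_sub_starProjection_le (ι : G ≃L[ℂ] H) (q : ℕ → G) (n : ℕ) (g : G) :
    ‖ι g - (trialSpace (fun k => ι (q k)) n).starProjection (ι g)‖ ≤
      ‖(ι : G →L[ℂ] H)‖ * ‖g - fourierSum q n g‖ := by
  have hmem : ι (fourierSum q n g) ∈ trialSpace (fun k => ι (q k)) n := by
    rw [fourierSum, map_sum]
    refine Submodule.sum_mem _ fun i hi => ?_
    rw [map_smul]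
    exact Submodule.smul_mem _ _ (Submodule.subset_span ⟨⟨i, Finset.mem_range.1 hi⟩, rfl⟩)
  refine (norm_sub_starProjection_le _ hmem).trans ?_
  rw [← map_sub]
  exact (ι : G →L[ℂ] H).le_opNorm _

theorem inner_symm_eq_zero_of_mem_trialSpace (ι : G ≃L[ℂ] H) {q : ℕ → G}
    (hq : Orthonormal ℂ q) {n k : ℕ} (hk : n ≤ k)
    {x : H} (hx : x ∈ trialSpace (fun i => ι (q i)) n) : inner ℂ (q k) (ι.symm x) = (0 : ℂ) := by
  induction hx using Submodule.span_induction with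
  | mem x hx =>
    obtain ⟨i, rfl⟩ := hx
    rw [ι.symm_apply_apply, hq.2 (by have := i.2; omega)]
  | zero => simp
  | add x y _ _ hx hy => rw [map_add, inner_add_right, hx, hy, add_zero]
  | smul a x _ hx => rw [map_smul, inner_smul_right, hx, mul_zero]

end TrialSpaces

/-! ### Norm approximation on the trial spaces and compactness -/

section Compactness

variable {H : Type*} [NormedAddCommGroup H] [InnerProductSpace ℂ H] [CompleteSpace H]
variable {G : Type*} [NormedAddCommGroup G] [InnerProductSpace ℂ G] [CompleteSpace G]

theorem tendsto_opNorm_rpow_half {T : H →L[ℂ] H} (hT : 0 ≤ T) (W : ℕ → Submodule ℂ H)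
    [∀ n, (W n).HasOrthogonalProjection] {s : ℝ} (hs : 0 ≤ s)
    (h : Tendsto (fun n => ‖(1 - (W n).starProjection) * (T ^ s : H →L[ℂ] H)‖) atTop (𝓝 0)) :
    Tendsto (fun n => ‖(1 - (W n).starProjection) * (T ^ (s / 2) : H →L[ℂ] H)‖) atTop (𝓝 0) := by
  have h1 : ∀ n, ‖(1 - (W n).starProjection) * (T ^ (s / 2) : H →L[ℂ] H)‖ ^ 2 ≤
      ‖(1 - (W n).starProjection) * (T ^ s : H →L[ℂ] H)‖ := by
    intro n
    set Z : H →L[ℂ] H := 1 - (W n).starProjection with hZ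
    have hZs : star Z = Z := by
      have : IsSelfAdjoint (W n).starProjection :=
        (Submodule.starProjection_isSymmetric (K := W n)).isSelfAdjoint
      rw [hZ, star_sub, star_one, this.star_eq]
    have hTs : star (T ^ (s / 2) : H →L[ℂ] H) = T ^ (s / 2) :=
      (IsSelfAdjoint.of_nonneg CFC.rpow_nonneg).star_eq
    have hZ1 : ‖Z‖ ≤ 1 := by
      refine ContinuousLinearMap.opNorm_le_bound _ zero_le_one fun x => ?_
      rw [one_mul]
      simpa [hZ] using norm_sub_starProjection_le (W := W n) x (zero_mem _)
    rw [sq, ← CStarRing.norm_self_mul_star, star_mul, hZs, hTs]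
    have h2 : Z * (T ^ (s / 2) : H →L[ℂ] H) * ((T ^ (s / 2) : H →L[ℂ] H) * Z) =
        Z * (T ^ s : H →L[ℂ] H) * Z := by
      conv_rhs => rw [← add_halves s, rpow_add_of_nonneg hT (by linarith) (by linarith)]
      simp only [mul_assoc]
    rw [h2]
    refine (norm_mul_le _ _).trans ?_
    exact mul_le_of_le_one_right (norm_nonneg _) hZ1
  have h3 : Tendsto (fun n => ‖(1 - (W n).starProjection) * (T ^ (s / 2) : H →L[ℂ] H)‖ ^ 2)
      atTop (𝓝 0) := squeeze_zero (fun n => sq_nonneg _) h1 h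
  have h4 := h3.sqrt
  simpa [Real.sqrt_sq] using h4

/-- If `(1 - Q n) T ^ τ → 0` in norm for some `τ > 0` and orthogonal projections `Q n`, then
`(1 - Q n) T → 0`. The `C*`-identity gives this for the halved exponents `τ / 2 ^ m`, and
`T ^ s` divides `T` as soon as `s ≤ 1`. -/
theorem tendsto_opNorm_of_rpow {T : H →L[ℂ] H} (hT : 0 ≤ T) (W : ℕ → Submodule ℂ H)
    [∀ n, (W n).HasOrthogonalProjection] {τ : ℝ} (hτ : 0 ≤ τ)
    (h : Tendsto (fun n => ‖(1 - (W n).starProjection) * (T ^ τ : H →L[ℂ] H)‖) atTop (𝓝 0)) :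
    Tendsto (fun n => ‖(1 - (W n).starProjection) * T‖) atTop (𝓝 0) := by
  have h1 : ∀ m : ℕ, Tendsto (fun n => ‖(1 - (W n).starProjection) *
      (T ^ (τ / 2 ^ m) : H →L[ℂ] H)‖) atTop (𝓝 0) := by
    intro m
    induction m with
    | zero => simpa using h
    | succ m ih =>
      have := tendsto_opNorm_rpow_half hT W (by positivity) ih
      rwa [div_div, ← pow_succ] at this
  obtain ⟨m, hm⟩ := pow_unbounded_of_one_lt τ (one_lt_two)
  set s : ℝ := τ / 2 ^ m with hs
  have hs0 : 0 ≤ s := by positivity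
  have hs1 : s ≤ 1 := (div_le_one (by positivity)).2 hm.le
  have h2 : T = T ^ s * T ^ (1 - s) := by
    rw [← rpow_add_of_nonneg hT hs0 (by linarith), add_sub_cancel, CFC.rpow_one T hT]
  have h3 : ∀ n, ‖(1 - (W n).starProjection) * T‖ ≤
      ‖(1 - (W n).starProjection) * (T ^ s : H →L[ℂ] H)‖ * ‖(T ^ (1 - s) : H →L[ℂ] H)‖ := by
    intro n
    conv_lhs => rw [h2, ← mul_assoc]
    exact norm_mul_le _ _
  refine squeeze_zero (fun n => norm_nonneg _) h3 ?_
  simpa using (h1 m).mul_const ‖(T ^ (1 - s) : H →L[ℂ] H)‖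

/-- The inverse of `A` is approximated in norm on the trial spaces, because `D(A^τ)` lies in
`D(M^τ)`, whose elements are approximated by their Fourier sums at the rate `μ n ^ (-τ)`. -/
theorem tendsto_opNorm_sub_starProjection (ι : G ≃L[ℂ] H)
    {A : H →ₗ.[ℂ] H} (hA : IsPosDefSelfAdjoint A)
    {M : G →ₗ.[ℂ] G} (hM : IsPosDefSelfAdjoint M) (hMc : IsCompactOperator (boundedInverse M))
    {μ : ℕ → ℝ} {q : ℕ → G} (hq : IsEigenEnumeration M μ q) {τ : ℝ} (hτ : 0 < τ)
    (hAM : ContinuouslyContained A M ι.symm τ) :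
    Tendsto (fun n => ‖(1 - (trialSpace (fun k => ι (q k)) n).starProjection) *
      boundedInverse A‖) atTop (𝓝 0) := by
  refine tendsto_opNorm_of_rpow hA.inverse_nonneg _ hτ.le ?_
  obtain ⟨C, hC⟩ := hAM
  have hbound : ∀ n, ‖(1 - (trialSpace (fun k => ι (q k)) n).starProjection) *
      ((boundedInverse A) ^ τ : H →L[ℂ] H)‖ ≤ ‖(ι : G →L[ℂ] H)‖ * |C| * μ n ^ (-τ) := by
    intro n
    have hμ := Real.rpow_nonneg (hq.pos hM n).le (-τ)
    refine ContinuousLinearMap.opNorm_le_bound _ (by positivity) fun x => ?_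
    obtain ⟨h1, h2⟩ := hC _ (rpow_mem_domain hτ x)
    rw [scaleNorm_rpow_apply hA hτ] at h2
    obtain ⟨y, hy⟩ := mem_fracPow_domain hτ |>.1 h1
    rw [← hy, scaleNorm_rpow_apply hM hτ] at h2
    have h3 := norm_map_sub_starProjection_le ι q n
      (ι.symm (((boundedInverse A) ^ τ : H →L[ℂ] H) x))
    have h4 := hq.norm_rpow_sub_fourierSum_le hM hMc hτ.le n y
    have h5 : ‖y - fourierSum q n y‖ ≤ ‖y‖ := by
      simpa only [hq.coe_basis] using norm_sub_fourierSum_le (hq.basis hM hMc) n y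
    rw [hy] at h4
    rw [ι.apply_symm_apply] at h3
    refine h3.trans ?_
    rw [mul_assoc, mul_assoc]
    refine mul_le_mul_of_nonneg_left (h4.trans ?_) (norm_nonneg _)
    rw [mul_left_comm]
    refine mul_le_mul_of_nonneg_left (h5.trans (h2.trans ?_)) hμ
    exact mul_le_mul_of_nonneg_right (le_abs_self C) (norm_nonneg _)
  refine squeeze_zero (fun n => norm_nonneg _) hbound ?_
  have h1 := (tendsto_rpow_neg_atTop hτ).comp (hq.tendsto_atTop hM hMc)
  simpa using h1.const_mul (‖(ι : G →L[ℂ] H)‖ * |C|)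

theorem isCompactOperator_of_tendsto_starProjection {T : H →L[ℂ] H} (W : ℕ → Submodule ℂ H)
    [∀ n, FiniteDimensional ℂ (W n)]
    (h : Tendsto (fun n => ‖(1 - (W n).starProjection) * T‖) atTop (𝓝 0)) :
    IsCompactOperator T := by
  refine isCompactOperator_of_tendsto (F := fun n => (W n).starProjection * T) (l := atTop) ?_
    (Eventually.of_forall fun n => ?_)
  · rw [tendsto_iff_norm_sub_tendsto_zero]
    refine h.congr fun n => ?_
    rw [norm_sub_rev, sub_mul, one_mul]
  · have h1 : IsCompactOperator (id : W n → W n) :=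
      isCompactOperator_id_iff_finiteDimensional (𝕜 := ℂ).2 inferInstance
    have h2 := (h1.comp_clm ((W n).orthogonalProjectionOnto.comp T)).clm_comp (W n).subtypeL
    exact h2

end Compactness

/-! ### Galerkin approximation of a positive operator -/

section Galerkin

variable {H : Type*} [NormedAddCommGroup H] [InnerProductSpace ℂ H]

theorem inner_sum_apply_sum {κ : Type*} [Fintype κ] [DecidableEq κ] {r : κ → H} {B : H →L[ℂ] H}
    {d : κ → ℝ} (h : ∀ i j, inner ℂ (r i) (B (r j)) = if i = j then (d j : ℂ) else 0)
    (c : κ → ℂ) :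
    (inner ℂ (∑ i, c i • r i) (B (∑ i, c i • r i)) : ℂ).re = ∑ i, d i * ‖c i‖ ^ 2 := by
  rw [map_sum, sum_inner, Complex.re_sum]
  refine Finset.sum_congr rfl fun i _ => ?_
  rw [inner_sum, Finset.sum_eq_single i]
  · rw [map_smul, inner_smul_left, inner_smul_right, h, if_pos rfl, ← mul_assoc, mul_comm,
      ← Complex.normSq_eq_conj_mul_self, Complex.normSq_eq_norm_sq, ← Complex.ofReal_mul,
      Complex.ofReal_re]
  · intro k _ hk
    rw [map_smul, inner_smul_left, inner_smul_right, h, if_neg hk.symm, mul_zero, mul_zero]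
  · simp

/-- `m` linear conditions on `m + 1` coefficients have a nontrivial solution. -/
theorem exists_orthogonal_combination {m : ℕ} (f : Fin m → H) (e : Fin (m + 1) → H) :
    ∃ c : Fin (m + 1) → ℂ, c ≠ 0 ∧ ∀ k, inner ℂ (f k) (∑ i, c i • e i) = (0 : ℂ) := by
  have h := LinearMap.ker_ne_bot_of_finrank_lt
    (f := (Matrix.of fun k i => (inner ℂ (f k) (e i) : ℂ)).mulVecLin) (by simp)
  obtain ⟨c, hc, hc0⟩ := Submodule.exists_mem_ne_zero_of_ne_bot h
  refine ⟨c, hc0, fun k => ?_⟩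
  have h1 := congrFun (LinearMap.mem_ker.1 hc) k
  rw [Matrix.mulVecLin_apply] at h1
  rw [inner_sum]
  simp only [Matrix.mulVec, dotProduct, Matrix.of_apply, Pi.zero_apply] at h1
  rw [← h1]
  exact Finset.sum_congr rfl fun i _ => by rw [inner_smul_right, mul_comm]

theorem sum_norm_sq_pos {κ : Type*} [Fintype κ] {c : κ → ℂ} (hc : c ≠ 0) :
    0 < ∑ i, ‖c i‖ ^ 2 := by
  obtain ⟨i, hi⟩ := Function.ne_iff.1 hc
  have h : 0 < ‖c i‖ ^ 2 := by have := norm_pos_iff.2 hi; positivity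
  exact h.trans_le (Finset.single_le_sum (f := fun i => ‖c i‖ ^ 2)
    (fun _ _ => sq_nonneg _) (Finset.mem_univ i))

theorem hasSum_re_inner {T : H →L[ℂ] H} (b : HilbertBasis ℕ ℂ H) {t : ℕ → ℝ}
    (hb : ∀ k x, inner ℂ (b k) (T x) = (t k : ℂ) * inner ℂ (b k) x) (x : H) :
    HasSum (fun k => t k * ‖(inner ℂ (b k) x : ℂ)‖ ^ 2) (inner ℂ x (T x) : ℂ).re := by
  have h := (b.hasSum_inner_mul_inner x (T x)).mapL Complex.reCLM
  simp only [Complex.reCLM_apply] at h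
  convert h using 2 with k
  rw [hb, ← inner_conj_symm x (b k), mul_left_comm, ← Complex.normSq_eq_conj_mul_self,
    ← Complex.ofReal_mul, Complex.ofReal_re, Complex.normSq_eq_norm_sq]

/-- A full set of Ritz pairs for the eigenvalue problem `x = Λ T x`, tested on the subspace `W`,
with Ritz vectors orthonormal for `⟨·, T ·⟩`. -/
structure IsGalerkinSystem (T : H →L[ℂ] H) (W : Submodule ℂ H) {n : ℕ} (Λ : Fin n → ℝ)
    (r : Fin n → H) : Prop where
  finrank_le : Module.finrank ℂ W ≤ n
  monotone : Monotone Λ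
  mem : ∀ j, r j ∈ W
  galerkin : ∀ j, ∀ w ∈ W, inner ℂ w (r j) = (Λ j : ℂ) * inner ℂ w (T (r j))
  orthonormal : ∀ i j, inner ℂ (r i) (T (r j)) = if i = j then (1 : ℂ) else 0

variable {T : H →L[ℂ] H} {W : Submodule ℂ H} {n : ℕ} {Λ : Fin n → ℝ} {r : Fin n → H}

theorem IsGalerkinSystem.inner_eq (h : IsGalerkinSystem T W Λ r) (i j : Fin n) :
    inner ℂ (r i) (r j) = if i = j then (Λ j : ℂ) else 0 := by
  rw [h.galerkin j _ (h.mem i), h.orthonormal]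
  split_ifs <;> simp

theorem IsGalerkinSystem.norm_sq (h : IsGalerkinSystem T W Λ r) (j : Fin n) :
    ‖r j‖ ^ 2 = Λ j := by
  have h1 := h.inner_eq j j
  rw [if_pos rfl, inner_self_eq_norm_sq_to_K, ← RCLike.ofReal_pow] at h1
  exact Complex.ofReal_injective h1

theorem IsGalerkinSystem.ne_zero (h : IsGalerkinSystem T W Λ r) (j : Fin n) : r j ≠ 0 := by
  intro h0
  have := h.orthonormal j j
  rw [h0, inner_zero_left, if_pos rfl] at this
  exact zero_ne_one this

theorem IsGalerkinSystem.pos (h : IsGalerkinSystem T W Λ r) (j : Fin n) : 0 < Λ j := by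
  rw [← h.norm_sq j]
  have := norm_pos_iff.2 (h.ne_zero j)
  positivity

theorem IsGalerkinSystem.projection_apply [W.HasOrthogonalProjection]
    (h : IsGalerkinSystem T W Λ r) (j : Fin n) :
    W.starProjection (T (r j)) = (((Λ j)⁻¹ : ℝ) : ℂ) • r j := by
  refine Submodule.eq_starProjection_of_mem_of_inner_eq_zero (W.smul_mem _ (h.mem j))
    (fun w hw => ?_)
  have hΛ : (Λ j : ℂ) ≠ 0 := by exact_mod_cast (h.pos j).ne'
  rw [← inner_conj_symm, inner_sub_right, inner_smul_right, h.galerkin j w hw, Complex.ofReal_inv,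
    inv_mul_cancel_left₀ hΛ, sub_self, map_zero]

theorem IsGalerkinSystem.span_eq [FiniteDimensional ℂ W] (h : IsGalerkinSystem T W Λ r) :
    Submodule.span ℂ (Set.range r) = W := by
  have hle : Submodule.span ℂ (Set.range r) ≤ W := by
    rw [Submodule.span_le]
    rintro _ ⟨j, rfl⟩
    exact h.mem j
  have hlin : LinearIndependent ℂ r := by
    refine linearIndependent_of_ne_zero_of_inner_eq_zero (𝕜 := ℂ) h.ne_zero fun i j hij => ?_
    exact (h.inner_eq i j).trans (if_neg hij)
  refine Submodule.eq_of_le_of_finrank_le hle ?_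
  rw [finrank_span_eq_card hlin, Fintype.card_fin]
  exact h.finrank_le

/-- The Ritz values are upper bounds: the span of the first `j + 1` Ritz vectors contains a
nonzero vector orthogonal to the first `j` eigenvectors. -/
theorem IsGalerkinSystem.inv_le (h : IsGalerkinSystem T W Λ r) (b : HilbertBasis ℕ ℂ H)
    {t : ℕ → ℝ} (ht : Antitone t)
    (hb : ∀ k x, inner ℂ (b k) (T x) = (t k : ℂ) * inner ℂ (b k) x) (j : Fin n) :
    (Λ j)⁻¹ ≤ t j := by
  have hjn : (j : ℕ) + 1 ≤ n := j.2
  obtain ⟨c, hc, horth⟩ := exists_orthogonal_combination (fun k : Fin j => b k)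
    (fun i : Fin (j + 1) => r (Fin.castLE hjn i))
  set x : H := ∑ i, c i • r (Fin.castLE hjn i) with hx
  have h1 : (inner ℂ x (T x) : ℂ).re = ∑ i, (1 : ℝ) * ‖c i‖ ^ 2 :=
    inner_sum_apply_sum (r := fun i : Fin (j + 1) => r (Fin.castLE hjn i)) (B := T)
      (d := fun _ => 1) (fun i k => by rw [h.orthonormal]; simp) c
  have h2 : (inner ℂ x x : ℂ).re = ∑ i, Λ (Fin.castLE hjn i) * ‖c i‖ ^ 2 :=
    inner_sum_apply_sum (r := fun i : Fin (j + 1) => r (Fin.castLE hjn i))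
      (B := ContinuousLinearMap.id ℂ H) (d := fun i => Λ (Fin.castLE hjn i))
      (fun i k => by rw [ContinuousLinearMap.id_apply, h.inner_eq]; simp) c
  have h2' : (inner ℂ x x : ℂ).re = ‖x‖ ^ 2 := by
    rw [inner_self_eq_norm_sq_to_K, ← RCLike.ofReal_pow]
    exact Complex.ofReal_re _
  have h3 : (inner ℂ x (T x) : ℂ).re ≤ t j * ‖x‖ ^ 2 := by
    refine hasSum_le (fun k => ?_) (hasSum_re_inner b hb x)
      ((hasSum_norm_inner_sq b x).mul_left (t j))
    rcases lt_or_ge k (j : ℕ) with hk | hk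
    · rw [horth ⟨k, hk⟩]; simp
    · exact mul_le_mul_of_nonneg_right (ht hk) (sq_nonneg _)
  have h4 : ∑ i, Λ (Fin.castLE hjn i) * ‖c i‖ ^ 2 ≤ Λ j * ∑ i, ‖c i‖ ^ 2 := by
    rw [Finset.mul_sum]
    refine Finset.sum_le_sum fun i _ => mul_le_mul_of_nonneg_right (h.monotone ?_) (sq_nonneg _)
    exact Fin.le_def.2 (Nat.lt_succ_iff.1 i.2)
  have h5 := sum_norm_sq_pos hc
  simp only [one_mul] at h1
  have hΛ := h.pos j
  have htj : 0 ≤ t j := by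
    by_contra hneg
    nlinarith [sq_nonneg ‖x‖]
  rw [inv_le_iff_one_le_mul₀ hΛ]
  refine le_of_mul_le_mul_right ?_ h5
  rw [one_mul, mul_assoc]
  calc ∑ i, ‖c i‖ ^ 2 ≤ t j * ‖x‖ ^ 2 := h1 ▸ h3
    _ ≤ t j * (Λ j * ∑ i, ‖c i‖ ^ 2) := by
      refine mul_le_mul_of_nonneg_left ?_ htj
      rw [← h2', h2]; exact h4

/-- The Ritz values converge at the rate `‖(1 - Q) T‖`: among the combinations `y` of the first
`j + 1` eigenvectors there is one orthogonal to the first `j` Ritz vectors, and its projection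
`Q y` to the trial space involves only Ritz vectors from the `j`-th on. -/
theorem IsGalerkinSystem.sub_le_inv [FiniteDimensional ℂ W]
    (h : IsGalerkinSystem T W Λ r) (hT : T.IsSymmetric)
    (b : HilbertBasis ℕ ℂ H) {t : ℕ → ℝ} (ht : Antitone t)
    (hb : ∀ k x, inner ℂ (b k) (T x) = (t k : ℂ) * inner ℂ (b k) x) (j : Fin n) :
    t j - 2 * ‖(1 - W.starProjection) * T‖ ≤ (Λ j)⁻¹ := by
  set ε := ‖(1 - W.starProjection) * T‖ with hε
  obtain ⟨a, ha, horth⟩ := exists_orthogonal_combination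
    (fun k : Fin j => r (Fin.castLE j.2.le k)) (fun i : Fin (j + 1) => b i)
  set y : H := ∑ i : Fin (j + 1), a i • b i with hy
  have hbi : ∀ i : Fin (j + 1), inner ℂ (b i) y = a i := fun i =>
    (b.orthonormal.comp (fun i : Fin (j + 1) => (i : ℕ)) Fin.val_injective).inner_right_fintype a i
  have hbk : ∀ k : ℕ, (j : ℕ) < k → inner ℂ (b k) y = (0 : ℂ) := by
    intro k hk
    rw [hy, inner_sum]
    refine Finset.sum_eq_zero fun i _ => ?_
    rw [inner_smul_right, b.orthonormal.2 (by have := i.2; omega), mul_zero]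
  have hy0 : 0 < ‖y‖ ^ 2 := by
    have : y ≠ 0 := by
      intro h0
      refine ha (funext fun i => ?_)
      rw [← hbi, h0, inner_zero_right]; rfl
    have := norm_pos_iff.2 this
    positivity
  have h1 : t j * ‖y‖ ^ 2 ≤ (inner ℂ y (T y) : ℂ).re := by
    refine hasSum_le (fun k => ?_) ((hasSum_norm_inner_sq b y).mul_left (t j))
      (hasSum_re_inner b hb y)
    rcases le_or_gt k (j : ℕ) with hk | hk
    · exact mul_le_mul_of_nonneg_right (ht hk) (sq_nonneg _)
    · rw [hbk k hk]; simp
  set z : H := W.starProjection y with hz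
  have hzW : z ∈ W := Submodule.starProjection_apply_mem _ _
  obtain ⟨c, hc⟩ : ∃ c : Fin n → ℂ, ∑ i, c i • r i = z := by
    rw [← h.span_eq] at hzW
    exact (Submodule.mem_span_range_iff_exists_fun ℂ).1 hzW
  have hci : ∀ i : Fin n, i < j → c i = 0 := by
    intro i hi
    have h2 : inner ℂ (r i) (T z) = c i := by
      rw [← hc, map_sum, inner_sum, Finset.sum_eq_single i]
      · rw [map_smul, inner_smul_right, h.orthonormal, if_pos rfl, mul_one]
      · intro k _ hk
        rw [map_smul, inner_smul_right, h.orthonormal, if_neg hk.symm, mul_zero]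
      · simp
    rw [← h2]
    have h3 : inner ℂ (r i) y = (0 : ℂ) := horth ⟨i, hi⟩
    have h4 : inner ℂ (T (r i)) z = inner ℂ (r i) (T z) := hT _ _
    rw [← h4, hz, ← Submodule.inner_starProjection_left_eq_right, h.projection_apply,
      inner_smul_left, h3, mul_zero]
  have h5 : (inner ℂ z (T z) : ℂ).re = ∑ i, (1 : ℝ) * ‖c i‖ ^ 2 := by
    rw [← hc]
    exact inner_sum_apply_sum (r := r) (B := T) (d := fun _ => 1)
      (fun i k => by rw [h.orthonormal]; simp) c
  have h6 : ‖z‖ ^ 2 = ∑ i, Λ i * ‖c i‖ ^ 2 := by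
    have h6' : (inner ℂ z z : ℂ).re = ‖z‖ ^ 2 := by
      rw [inner_self_eq_norm_sq_to_K, ← RCLike.ofReal_pow]
      exact Complex.ofReal_re _
    rw [← h6', ← hc]
    exact inner_sum_apply_sum (r := r) (B := ContinuousLinearMap.id ℂ H) (d := Λ)
      (fun i k => by rw [ContinuousLinearMap.id_apply, h.inner_eq]) c
  have h7 : Λ j * (inner ℂ z (T z) : ℂ).re ≤ ‖z‖ ^ 2 := by
    rw [h5, h6, Finset.mul_sum]
    refine Finset.sum_le_sum fun i _ => ?_
    rw [one_mul]
    rcases lt_or_ge i j with hi | hi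
    · rw [hci i hi]; simp
    · exact mul_le_mul_of_nonneg_right (h.monotone hi) (sq_nonneg _)
  have hzy : ‖z‖ ≤ ‖y‖ := Submodule.norm_starProjection_apply_le _ _
  have hsub : ∀ x, ‖T x - W.starProjection (T x)‖ ≤ ε * ‖x‖ := fun x =>
    ((1 - W.starProjection) * T).le_opNorm x
  have h8 : (inner ℂ y (T y) : ℂ) - inner ℂ z (T z) =
      inner ℂ y (T y - W.starProjection (T y)) + inner ℂ (T z - W.starProjection (T z)) y := by
    have e1 : (inner ℂ y (W.starProjection (T y)) : ℂ) = inner ℂ z (T y) := by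
      rw [hz, Submodule.inner_starProjection_left_eq_right]
    have e2 : (inner ℂ (W.starProjection (T z)) y : ℂ) = inner ℂ (T z) z := by
      rw [Submodule.inner_starProjection_left_eq_right]
    have e3 : (inner ℂ (T z) z : ℂ) = inner ℂ z (T z) := hT z z
    have e4 : (inner ℂ (T z) y : ℂ) = inner ℂ z (T y) := hT z y
    rw [inner_sub_right, inner_sub_left, e1, e2, e3, e4]
    ring
  have h9 : (inner ℂ y (T y) : ℂ).re - (inner ℂ z (T z) : ℂ).re ≤ 2 * ε * ‖y‖ ^ 2 := by
    rw [← Complex.sub_re, h8, Complex.add_re]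
    have f1 : (inner ℂ y (T y - W.starProjection (T y)) : ℂ).re ≤ ‖y‖ * (ε * ‖y‖) :=
      (Complex.re_le_norm _).trans ((norm_inner_le_norm _ _).trans
        (mul_le_mul_of_nonneg_left (hsub y) (norm_nonneg _)))
    have f2 : (inner ℂ (T z - W.starProjection (T z)) y : ℂ).re ≤ ε * ‖y‖ * ‖y‖ :=
      (Complex.re_le_norm _).trans ((norm_inner_le_norm _ _).trans
        (mul_le_mul_of_nonneg_right ((hsub z).trans
          (mul_le_mul_of_nonneg_left hzy (norm_nonneg _))) (norm_nonneg _)))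
    nlinarith
  have h10 : ‖z‖ ^ 2 ≤ ‖y‖ ^ 2 := pow_le_pow_left₀ (norm_nonneg _) hzy 2
  have hΛ := h.pos j
  rw [← one_div, le_div_iff₀ hΛ]
  refine le_of_mul_le_mul_right ?_ hy0
  have h11 : (t j - 2 * ε) * ‖y‖ ^ 2 ≤ (inner ℂ z (T z) : ℂ).re := by linarith
  linarith [mul_le_mul_of_nonneg_left h11 hΛ.le]

/-- A value `s` of an antitone sequence is isolated once the sequence drops below it: only finitely
many terms before that compete, and all later ones are at least as far away as the first of them. -/
theorem exists_gap {t : ℕ → ℝ} (ht : Antitone t) {s : ℝ} {ℓ : ℕ} (hs : t ℓ < s) :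
    ∃ δ : ℝ, 0 < δ ∧ ∀ k, k ∉ (Finset.range ℓ).filter (fun k => t k = s) → 2 * δ ≤ |t k - s| := by
  have h1 : ∀ᶠ δ in 𝓝[>] (0 : ℝ), ∀ k ∈ (Finset.range (ℓ + 1)).filter (fun k => t k ≠ s),
      2 * δ ≤ |t k - s| := by
    refine (Finset.eventually_all _).2 fun k hk => ?_
    have h2 : 0 < |t k - s| / 2 :=
      half_pos (abs_pos.2 (sub_ne_zero.2 (Finset.mem_filter.1 hk).2))
    filter_upwards [nhdsWithin_le_nhds (Iio_mem_nhds h2)] with δ hδ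
    have : δ < |t k - s| / 2 := hδ
    linarith
  obtain ⟨δ, hδ, hδ0⟩ := (h1.and self_mem_nhdsWithin).exists
  refine ⟨δ, hδ0, fun k hk => ?_⟩
  rcases lt_or_ge k ℓ with hkℓ | hkℓ
  · refine hδ k (Finset.mem_filter.2 ⟨Finset.mem_range.2 (by omega), fun h => hk ?_⟩)
    exact Finset.mem_filter.2 ⟨Finset.mem_range.2 hkℓ, h⟩
  · have h3 := hδ ℓ (Finset.mem_filter.2 ⟨Finset.mem_range.2 (by omega), hs.ne⟩)
    have h4 := ht hkℓ
    rw [abs_of_neg (by linarith)] at h3 ⊢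
    linarith

/-- The error of a Ritz vector is controlled by the approximation error of its own component in
the eigenspace. Indeed `(t k - θ) ⟨b k, r⟩ = ⟨b k, (1 - Q) T r⟩`, and the part of `(1 - Q) T r`
that comes from the other eigenspaces is absorbed, `‖(1 - Q) T‖` being small. -/
theorem norm_sub_eigencomponent_le [W.HasOrthogonalProjection] (b : HilbertBasis ℕ ℂ H)
    {t : ℕ → ℝ} (hb : ∀ k x, inner ℂ (b k) (T x) = (t k : ℂ) * inner ℂ (b k) x)
    {F : Finset ℕ} {s θ δ : ℝ} {x : H} (hx : W.starProjection (T x) = (θ : ℂ) • x)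
    (hs : 0 ≤ s) (hδ : 0 < δ) (hTF : T (∑ k ∈ F, (inner ℂ (b k) x : ℂ) • b k) =
      (s : ℂ) • ∑ k ∈ F, (inner ℂ (b k) x : ℂ) • b k)
    (hgap : ∀ k ∉ F, 2 * δ ≤ |t k - s|) (hθ : |θ - s| ≤ δ)
    (hε : 2 * ‖(1 - W.starProjection) * T‖ ≤ δ) :
    ‖x - ∑ k ∈ F, (inner ℂ (b k) x : ℂ) • b k‖ ≤
      2 * s / δ * (‖x‖ * ∑ k ∈ F, ‖b k - W.starProjection (b k)‖) := by
  set p : H := ∑ k ∈ F, (inner ℂ (b k) x : ℂ) • b k with hp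
  have h1 : ∀ k, inner ℂ (b k) (x - p) = if k ∈ F then (0 : ℂ) else inner ℂ (b k) x := by
    intro k
    rw [inner_sub_right, hp]
    split_ifs with hk
    · rw [b.orthonormal.inner_right_sum (fun i => (inner ℂ (b i) x : ℂ)) hk, sub_self]
    · rw [inner_sum, Finset.sum_eq_zero, sub_zero]
      intro i hi
      rw [inner_smul_right, b.orthonormal.2 (by rintro rfl; exact hk hi), mul_zero]
  have h2 : ‖x - p‖ ≤ δ⁻¹ * ‖T x - W.starProjection (T x)‖ := by
    refine norm_le_mul_of_coord_le b (inv_nonneg.2 hδ.le) fun k => ?_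
    rw [h1]
    split_ifs with hk
    · rw [norm_zero]; positivity
    · have h3 : inner ℂ (b k) (T x - W.starProjection (T x)) =
          ((t k - θ : ℝ) : ℂ) * inner ℂ (b k) x := by
        rw [hx, inner_sub_right, hb, inner_smul_right]
        push_cast; ring
      have h4 : δ ≤ |t k - θ| := by
        have e1 := hgap k hk
        have e2 := abs_sub_le (t k) θ s
        linarith
      rw [h3, norm_mul, Complex.norm_real, Real.norm_eq_abs, ← mul_assoc]
      refine le_mul_of_one_le_left (norm_nonneg _) ?_
      rw [inv_mul_eq_div, one_le_div hδ]
      exact h4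
  have h5 : T x - W.starProjection (T x) = (s : ℂ) • (p - W.starProjection p) +
      ((1 - W.starProjection) * T) (x - p) := by
    have e1 : ((1 - W.starProjection) * T) (x - p) =
        T x - W.starProjection (T x) - (T p - W.starProjection (T p)) := by
      rw [map_sub]; rfl
    rw [e1, hTF, map_smul, smul_sub]
    abel
  have h6 : ‖T x - W.starProjection (T x)‖ ≤ s * ‖p - W.starProjection p‖ +
      ‖(1 - W.starProjection) * T‖ * ‖x - p‖ := by
    rw [h5]
    refine (norm_add_le _ _).trans (add_le_add ?_ (ContinuousLinearMap.le_opNorm _ _))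
    rw [norm_smul, Complex.norm_real, Real.norm_eq_abs, abs_of_nonneg hs]
  have h7 : ‖p - W.starProjection p‖ ≤ ‖x‖ * ∑ k ∈ F, ‖b k - W.starProjection (b k)‖ := by
    have e1 : p - W.starProjection p =
        ∑ k ∈ F, (inner ℂ (b k) x : ℂ) • (b k - W.starProjection (b k)) := by
      rw [hp, map_sum, ← Finset.sum_sub_distrib]
      exact Finset.sum_congr rfl fun k _ => by rw [map_smul, smul_sub]
    rw [e1, Finset.mul_sum]
    refine (norm_sum_le _ _).trans (Finset.sum_le_sum fun k _ => ?_)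
    rw [norm_smul]
    refine mul_le_mul_of_nonneg_right ?_ (norm_nonneg _)
    exact (norm_inner_le_norm _ _).trans (by rw [b.orthonormal.1 k, one_mul])
  rw [inv_mul_eq_div, le_div_iff₀ hδ] at h2
  have h8 : ‖x - p‖ * δ ≤ 2 * (s * ‖p - W.starProjection p‖) := by
    have := mul_le_mul_of_nonneg_right hε (norm_nonneg (x - p))
    linarith
  rw [div_mul_eq_mul_div, le_div_iff₀ hδ]
  refine h8.trans ?_
  rw [mul_assoc]
  exact mul_le_mul_of_nonneg_left (mul_le_mul_of_nonneg_left h7 hs) zero_le_two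

/-- Normalizing the eigenspace component `p` of a vector `x` in the seminorm `‖R ·‖`, in which
`x` is normalized, keeps its distance to `x` of the order of `‖x - p‖`. -/
theorem norm_normalize_sub_le {R : H →L[ℂ] H} {x p : H} {a : ℝ} (ha : 0 < a) (hx : ‖R x‖ = 1)
    (hp : ‖R p‖ = a * ‖p‖) (hsmall : ‖R‖ * ‖x - p‖ ≤ 1 / 2) :
    0 < ‖R p‖ ∧ ‖((‖R p‖⁻¹ : ℝ) : ℂ) • p - x‖ ≤ (1 + ‖R‖ / a) * ‖x - p‖ := by
  have h1 : |1 - ‖R p‖| ≤ ‖R‖ * ‖x - p‖ := by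
    rw [← hx]
    refine (abs_norm_sub_norm_le _ _).trans ?_
    rw [← map_sub]
    exact R.le_opNorm _
  have h2 : 0 < ‖R p‖ := by
    have := (abs_le.1 h1).2
    linarith
  refine ⟨h2, ?_⟩
  have h3 : ((‖R p‖⁻¹ : ℝ) : ℂ) • p - x = ((‖R p‖⁻¹ - 1 : ℝ) : ℂ) • p - (x - p) := by
    push_cast
    rw [sub_smul, one_smul]; abel
  have h4 : ‖((‖R p‖⁻¹ - 1 : ℝ) : ℂ) • p‖ = |1 - ‖R p‖| / a := by
    have e1 : ‖p‖ = ‖R p‖ / a := by rw [hp]; field_simp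
    have e2 : ‖R p‖⁻¹ - 1 = (1 - ‖R p‖) / ‖R p‖ := by field_simp
    rw [norm_smul, Complex.norm_real, Real.norm_eq_abs, e2, abs_div, abs_of_pos h2, e1]
    field_simp
  rw [h3]
  refine (norm_sub_le _ _).trans ?_
  rw [h4, add_mul, one_mul, add_comm, div_mul_eq_mul_div]
  gcongr

end Galerkin

/-! ### Eigenvectors in the scale of spaces -/

section EigenvectorsInScale

theorem InEigenspace.smul {E : Type*} [NormedAddCommGroup E] [InnerProductSpace ℂ E]
    {A : E →ₗ.[ℂ] E} {c : ℝ} {x : E} (hx : InEigenspace A c x) (a : ℂ) :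
    InEigenspace A c (a • x) := by
  obtain ⟨h1, h2⟩ := hx
  refine ⟨A.domain.smul_mem a h1, ?_⟩
  have h3 := LinearPMap.map_smul A a ⟨x, h1⟩
  rw [h2] at h3
  rw [smul_comm, ← h3]
  rfl

variable {E : Type*} [NormedAddCommGroup E] [InnerProductSpace ℂ E] [CompleteSpace E]
  {A : E →ₗ.[ℂ] E}

theorem InEigenspace.rpow_apply (hA : IsPosDefSelfAdjoint A) {c : ℝ} (hc : 0 < c) {x : E}
    (hx : InEigenspace A c x) {s : ℝ} (hs : 0 ≤ s) :
    ((boundedInverse A) ^ s : E →L[ℂ] E) x = ((c⁻¹ ^ s : ℝ) : ℂ) • x :=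
  rpow_apply_of_eigen hA.inverse_nonneg (inv_nonneg.2 hc.le) ((hA.inEigenspace_iff hc.ne' x).1 hx)
    hs

theorem InEigenspace.mem_domain (hA : IsPosDefSelfAdjoint A) {c : ℝ} (hc : 0 < c) {x : E}
    (hx : InEigenspace A c x) {s : ℝ} (hs : 0 < s) : x ∈ (fracPow A s).domain := by
  have h0 : ((c⁻¹ ^ s : ℝ) : ℂ) ≠ 0 := by
    exact_mod_cast (Real.rpow_pos_of_pos (inv_pos.2 hc) s).ne'
  refine (mem_fracPow_domain hs).2 ⟨((c⁻¹ ^ s : ℝ) : ℂ)⁻¹ • x, ?_⟩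
  rw [map_smul, hx.rpow_apply hA hc hs.le, inv_smul_smul₀ h0]

theorem scaleNorm_neg_half (x : E) :
    scaleNorm A (-1 / 2) x = ‖((boundedInverse A) ^ (1 / 2 : ℝ) : E →L[ℂ] E) x‖ := by
  rw [scaleNorm_of_nonpos (by norm_num)]
  norm_num

theorem InEigenspace.norm_rpow_half (hA : IsPosDefSelfAdjoint A) {c : ℝ} (hc : 0 < c) {x : E}
    (hx : InEigenspace A c x) :
    ‖((boundedInverse A) ^ (1 / 2 : ℝ) : E →L[ℂ] E) x‖ = (√c)⁻¹ * ‖x‖ := by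
  rw [hx.rpow_apply hA hc (by norm_num), ← Real.sqrt_eq_rpow, Real.sqrt_inv, norm_smul,
    Complex.norm_real, Real.norm_eq_abs, abs_of_nonneg (inv_nonneg.2 (Real.sqrt_nonneg c))]

theorem scaleNorm_nonneg (s : ℝ) (x : E) : 0 ≤ scaleNorm A s x := by
  rw [scaleNorm]
  split_ifs
  · exact norm_nonneg _
  · exact le_rfl

end EigenvectorsInScale

/-! ### Dual harmonic Ritz systems as Galerkin systems -/

section RitzSystems

variable {H : Type*} [NormedAddCommGroup H] [InnerProductSpace ℂ H] [CompleteSpace H]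
  {A : H →ₗ.[ℂ] H}

/-- The dual harmonic Ritz problem is the Galerkin problem for `x = Λ A⁻¹ x` on the trial
space. -/
theorem IsRitzSystem.isGalerkinSystem (hA : IsPosDefSelfAdjoint A) {w : ℕ → H} {n : ℕ}
    {Λ : Fin n → ℝ} {r : Fin n → H} (h : IsRitzSystem A 0 w n Λ r) :
    IsGalerkinSystem (boundedInverse A) (trialSpace w n) Λ r where
  finrank_le := by
    have := finrank_range_le_card (R := ℂ) (fun i : Fin n => w i)
    rwa [Fintype.card_fin] at this
  monotone := h.monotone
  mem j := by
    obtain ⟨x, hx, -⟩ := h.eigen j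
    rw [hx]
    exact Submodule.sum_mem _ fun i _ => Submodule.smul_mem _ _ (Submodule.subset_span ⟨i, rfl⟩)
  galerkin j := by
    obtain ⟨x, hx, hmat⟩ := h.eigen j
    have hsymm := ((ContinuousLinearMap.nonneg_iff_isPositive _).1 hA.inverse_nonneg).isSymmetric
    intro y hy
    induction hy using Submodule.span_induction with
    | mem y hy =>
      obtain ⟨i, rfl⟩ := hy
      have h1 := congrFun hmat i
      simp only [Matrix.mulVec, dotProduct, Matrix.of_apply, Pi.smul_apply, scaleInner_zero hA,
        smul_eq_mul] at h1
      have h2 : inner ℂ (w i) (boundedInverse A (r j)) = inner ℂ (boundedInverse A (w i)) (r j) :=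
        (hsymm (w i) (r j)).symm
      rw [h2, hx, inner_sum, inner_sum]
      simp only [inner_smul_right]
      rw [← Finset.sum_congr rfl fun k _ => mul_comm _ _, h1]
      congr 1
      exact Finset.sum_congr rfl fun k _ => mul_comm _ _
    | zero => simp
    | add y z _ _ hy hz => rw [inner_add_left, inner_add_left, hy, hz, mul_add]
    | smul a y _ hy => rw [inner_smul_left, inner_smul_left, hy, mul_left_comm]
  orthonormal i j := by
    rw [← scaleInner_neg_half hA]
    exact h.orthonormal i j

end RitzSystems

/-! ### Inverse and smoothness estimates -/

section SmoothScale

variable {G : Type*} [NormedAddCommGroup G] [InnerProductSpace ℂ G] [CompleteSpace G]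
  {M : G →ₗ.[ℂ] G} {μ : ℕ → ℝ} {q : ℕ → G}

/-- An inverse estimate on the first `n` modes combined with a smoothness estimate on the others:
if `z = M⁻¹^τ w` has the same coordinates as some `M⁻¹^σ y` from the `n`-th on, then `‖M^τ z‖` is
bounded by `μ n ^ τ ‖z‖` and the Fourier tail of `y`. -/
theorem IsEigenEnumeration.norm_le_of_tail_eq (hM : IsPosDefSelfAdjoint M)
    (hMc : IsCompactOperator (boundedInverse M)) (hq : IsEigenEnumeration M μ q) {τ σ : ℝ}
    (hτ : 0 ≤ τ) (hσ : τ ≤ σ) (n : ℕ) {w y : G}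
    (h : ∀ k, n ≤ k → inner ℂ (q k) (((boundedInverse M) ^ τ : G →L[ℂ] G) w) =
      (inner ℂ (q k) (((boundedInverse M) ^ σ : G →L[ℂ] G) y) : ℂ)) :
    ‖w‖ ≤ μ n ^ τ * ‖((boundedInverse M) ^ τ : G →L[ℂ] G) w‖ +
      μ n ^ (τ - σ) * ‖y - fourierSum q n y‖ := by
  set z := ((boundedInverse M) ^ τ : G →L[ℂ] G) w with hz
  have hμ := hq.pos hM
  have hwz : ∀ k, ‖(inner ℂ (q k) w : ℂ)‖ = μ k ^ τ * ‖(inner ℂ (q k) z : ℂ)‖ := by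
    intro k
    rw [hz, hq.inner_rpow hM hτ, norm_mul, Complex.norm_real, Real.norm_eq_abs,
      abs_of_nonneg (Real.rpow_nonneg (hμ k).le _), ← mul_assoc, ← Real.rpow_add (hμ k),
      add_neg_cancel, Real.rpow_zero, one_mul]
  have hcoord := hq.coe_basis hM hMc
  have hsum : ‖w‖ ^ 2 ≤ (μ n ^ τ) ^ 2 * ‖z‖ ^ 2 +
      (μ n ^ (τ - σ)) ^ 2 * ‖y - fourierSum q n y‖ ^ 2 := by
    refine hasSum_le (fun k => ?_) (hasSum_norm_inner_sq (hq.basis hM hMc) w)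
      (((hasSum_norm_inner_sq (hq.basis hM hMc) z).mul_left _).add
        ((hasSum_norm_inner_sq (hq.basis hM hMc) (y - fourierSum q n y)).mul_left _))
    rw [hcoord, ← mul_pow, ← mul_pow]
    rcases lt_or_ge k n with hk | hk
    · refine le_add_of_le_of_nonneg (pow_le_pow_left₀ (norm_nonneg _) ?_ 2) (sq_nonneg _)
      rw [hwz]
      exact mul_le_mul_of_nonneg_right (Real.rpow_le_rpow (hμ k).le (hq.monotone hk.le) hτ)
        (norm_nonneg _)
    · refine le_add_of_nonneg_of_le (sq_nonneg _) (pow_le_pow_left₀ (norm_nonneg _) ?_ 2)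
      rw [inner_sub_fourierSum hq.orthonormal, if_neg hk.not_gt, hwz, h k hk,
        hq.inner_rpow hM (hτ.trans hσ), norm_mul, Complex.norm_real, Real.norm_eq_abs,
        abs_of_nonneg (Real.rpow_nonneg (hμ k).le _), ← mul_assoc, ← Real.rpow_add (hμ k),
        ← sub_eq_add_neg]
      exact mul_le_mul_of_nonneg_right (Real.rpow_le_rpow_of_nonpos (hμ n) (hq.monotone hk)
        (sub_nonpos.2 hσ)) (norm_nonneg _)
  have hn1 := Real.rpow_nonneg (hμ n).le τ
  have hn2 := Real.rpow_nonneg (hμ n).le (τ - σ)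
  refine le_of_sq_le_sq (hsum.trans ?_) (by positivity)
  rw [← mul_pow, ← mul_pow, add_sq]
  have : 0 ≤ 2 * (μ n ^ τ * ‖z‖) * (μ n ^ (τ - σ) * ‖y - fourierSum q n y‖) := by positivity
  linarith

theorem mem_domain_of_mem_trialSpace {H : Type*} [NormedAddCommGroup H]
    [InnerProductSpace ℂ H] [CompleteSpace H] {A : H →ₗ.[ℂ] H} (ι : G ≃L[ℂ] H)
    (hM : IsPosDefSelfAdjoint M) (hq : IsEigenEnumeration M μ q) {τ : ℝ} (hτ : 0 < τ)
    (hMA : ContinuouslyContained M A ι τ) {n : ℕ} {x : H}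
    (hx : x ∈ trialSpace (fun i => ι (q i)) n) : x ∈ (fracPow A τ).domain := by
  obtain ⟨C, hC⟩ := hMA
  refine (Submodule.span_le (p := (fracPow A τ).domain)).2 ?_ hx
  rintro _ ⟨i, rfl⟩
  exact (hC _ ((hq.eigen i).mem_domain hM (hq.pos hM i) hτ)).1

end SmoothScale

/-! ### Convergence of the Ritz vectors in the scale of spaces -/

section Convergence

variable {H : Type*} [NormedAddCommGroup H] [InnerProductSpace ℂ H] [CompleteSpace H]
  {G : Type*} [NormedAddCommGroup G] [InnerProductSpace ℂ G] [CompleteSpace G]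
  {A : H →ₗ.[ℂ] H} {M : G →ₗ.[ℂ] G} {μ : ℕ → ℝ} {q : ℕ → G}

/-- Passage from the norm of `H` to the norm of `D(A^τ)` for `v - x`, where `x` is a trial vector
and `v` corresponds to an element of `D(M^σ)`. -/
theorem scaleNorm_sub_le (ι : G ≃L[ℂ] H) (hM : IsPosDefSelfAdjoint M)
    (hMc : IsCompactOperator (boundedInverse M))
    (hq : IsEigenEnumeration M μ q) {τ σ : ℝ} (hτ : 0 < τ) (hσ : τ ≤ σ)
    (hAM : ContinuouslyContained A M ι.symm τ) {C : ℝ}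
    (hC : ∀ x : G, x ∈ (fracPow M τ).domain →
      ι x ∈ (fracPow A τ).domain ∧ scaleNorm A τ (ι x) ≤ C * scaleNorm M τ x)
    {n : ℕ} {v x : H} (hmem : v - x ∈ (fracPow A τ).domain)
    (hx : x ∈ trialSpace (fun i => ι (q i)) n) {y : G}
    (hy : ι.symm v = ((boundedInverse M) ^ σ : G →L[ℂ] G) y) :
    scaleNorm A τ (v - x) ≤ |C| * (μ n ^ τ * (‖(ι.symm : H →L[ℂ] G)‖ * ‖v - x‖) +
      μ n ^ (τ - σ) * ‖y - fourierSum q n y‖) := by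
  obtain ⟨C', hC'⟩ := hAM
  obtain ⟨w, hw⟩ := (mem_fracPow_domain hτ).1 (hC' _ hmem).1
  have h1 := (hC _ (hC' _ hmem).1).2
  rw [ι.apply_symm_apply, ← hw, scaleNorm_rpow_apply hM hτ] at h1
  have h2 := hq.norm_le_of_tail_eq hM hMc hτ.le hσ n (w := w) (y := y) fun k hk => by
    rw [hw, map_sub, inner_sub_right, inner_symm_eq_zero_of_mem_trialSpace ι hq.orthonormal hk hx,
      sub_zero, hy]
  have h3 : ‖ι.symm (v - x)‖ ≤ ‖(ι.symm : H →L[ℂ] G)‖ * ‖v - x‖ :=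
    (ι.symm : H →L[ℂ] G).le_opNorm _
  have hμ := Real.rpow_nonneg (hq.pos hM n).le τ
  rw [hw] at h2
  calc scaleNorm A τ (v - x) ≤ C * ‖w‖ := h1
    _ ≤ |C| * ‖w‖ := mul_le_mul_of_nonneg_right (le_abs_self C) (norm_nonneg _)
    _ ≤ _ := mul_le_mul_of_nonneg_left (h2.trans (by gcongr)) (abs_nonneg C)

/-- The quantitative core: the Ritz vector `x n` is approximated by normalized eigenvectors, in
the norm of `D(A^τ)`, up to `μ n ^ (τ - σ)` times a null sequence. -/
theorem exists_eigenvector_scaleNorm_sub_le (ι : G ≃L[ℂ] H) (hA : IsPosDefSelfAdjoint A)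
    {lam : ℕ → ℝ} {u : ℕ → H} (hu : IsEigenEnumeration A lam u)
    (hM : IsPosDefSelfAdjoint M) (hMc : IsCompactOperator (boundedInverse M))
    (hq : IsEigenEnumeration M μ q) {Λ : ℕ → ℕ → ℝ} {r : ℕ → ℕ → H}
    (hr : ∀ n : ℕ, IsRitzSystem A 0 (fun k => ι (q k)) n (fun i => Λ n i) (fun i => r n i))
    {τ σ : ℝ} (hτ : 0 < τ) (hσ : τ ≤ σ) (hMA : ContinuouslyContained M A ι τ)
    (hAM : ContinuouslyContained A M ι.symm τ) {j ℓ : ℕ} (hj : lam j < lam ℓ)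
    (hsmooth : ∀ k < ℓ, ι.symm (u k) ∈ (fracPow M σ).domain) :
    ∃ (K : ℝ) (d : ℕ → ℝ), Tendsto d atTop (𝓝 0) ∧ ∀ᶠ n in atTop, ∃ v : H,
      InEigenspace A (lam j) v ∧ scaleNorm A (-1 / 2) v = 1 ∧
      scaleNorm A τ (v - r n j) ≤ K * (d n * μ n ^ (τ - σ)) := by
  have hσ0 : 0 < σ := hτ.trans_le hσ
  set T := boundedInverse A with hTdef
  have hT := hA.inverse_nonneg
  have hsymm := ((ContinuousLinearMap.nonneg_iff_isPositive _).1 hT).isSymmetric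
  set W : ℕ → Submodule ℂ H := trialSpace (fun k => ι (q k))
  have hε : Tendsto (fun n => ‖(1 - (W n).starProjection) * T‖) atTop (𝓝 0) :=
    tendsto_opNorm_sub_starProjection ι hA hM hMc hq hτ hAM
  have hTc : IsCompactOperator T := isCompactOperator_of_tendsto_starProjection W hε
  set b := hu.basis hA hTc
  have hbu : ∀ k, b k = u k := fun k => congrFun (hu.coe_basis hA hTc) k
  have hlam := hu.pos hA
  set t : ℕ → ℝ := fun k => (lam k)⁻¹
  have htanti : Antitone t := fun k l hkl => inv_anti₀ (hlam k) (hu.monotone hkl)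
  have hbT : ∀ k x, inner ℂ (b k) (T x) = (t k : ℂ) * inner ℂ (b k) x := by
    intro k x
    have h1 : inner ℂ (T (b k)) x = inner ℂ (b k) (T x) := hsymm (b k) x
    rw [← h1, hbu, hTdef, hu.inverse_apply hA, inner_smul_left, Complex.conj_ofReal]
  set s : ℝ := t j
  have hs0 : 0 < s := inv_pos.2 (hlam j)
  -- indices of the eigenvectors for `lam j`; the gap puts all of them below `ℓ`
  set F := (Finset.range ℓ).filter (fun k => t k = s)
  obtain ⟨δ, hδ0, hδ⟩ := exists_gap htanti (s := s) (ℓ := ℓ) (inv_strictAnti₀ (hlam j) hj)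
  -- preimages `y k` of the eigenvectors under `M⁻¹^σ`
  have hex : ∀ k, ∃ y, k < ℓ → ((boundedInverse M) ^ σ : G →L[ℂ] G) y = ι.symm (u k) := by
    intro k
    by_cases hk : k < ℓ
    · obtain ⟨y, hy⟩ := (mem_fracPow_domain hσ0).1 (hsmooth k hk)
      exact ⟨y, fun _ => hy⟩
    · exact ⟨0, fun h => absurd h hk⟩
  choose y hy using hex
  set d : ℕ → ℝ := fun n => ∑ k ∈ F, ‖y k - fourierSum q n (y k)‖ with hd
  have hd0 : Tendsto d atTop (𝓝 0) := by
    rw [← Finset.sum_const_zero (s := F) (ι := ℕ)]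
    refine tendsto_finsetSum _ fun k _ => ?_
    simpa only [hq.coe_basis] using tendsto_sub_fourierSum (hq.basis hM hMc) (y k)
  set N := ‖(ι : G →L[ℂ] H)‖
  set N' := ‖(ι.symm : H →L[ℂ] G)‖
  have hμ := hq.pos hM
  have happrox : ∀ n, ∑ k ∈ F, ‖b k - (W n).starProjection (b k)‖ ≤
      N * (μ n ^ (-σ) * d n) := by
    intro n
    rw [hd, Finset.mul_sum, Finset.mul_sum]
    refine Finset.sum_le_sum fun k hk => ?_
    have h1 := norm_map_sub_starProjection_le ι q n (ι.symm (u k))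
    have h2 := hq.norm_rpow_sub_fourierSum_le hM hMc hσ0.le n (y k)
    rw [hy k (Finset.mem_range.1 (Finset.mem_filter.1 hk).1)] at h2
    rw [ι.apply_symm_apply] at h1
    rw [hbu]
    exact h1.trans (mul_le_mul_of_nonneg_left h2 (norm_nonneg _))
  -- `‖R ·‖` is the norm of index `-1/2`, equal to `a ‖·‖` on the `lam j`-eigenspace
  set R : H →L[ℂ] H := T ^ (1 / 2 : ℝ) with hR
  set a : ℝ := (√(lam j))⁻¹
  have ha0 : 0 < a := inv_pos.2 (Real.sqrt_pos.2 (hlam j))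
  -- `√(2 / s)` bounds the norms of the Ritz vectors, whose squares are the Ritz values
  set K₁ : ℝ := 2 * s / δ * (√(2 / s) * N) with hK₁
  have hlim : Tendsto (fun n => ‖R‖ * (K₁ * (μ n ^ (-σ) * d n))) atTop (𝓝 0) := by
    have h1 := (tendsto_rpow_neg_atTop hσ0).comp (hq.tendsto_atTop hM hMc)
    simpa using ((h1.mul hd0).const_mul K₁).const_mul ‖R‖
  obtain ⟨C, hC⟩ := hMA
  refine ⟨|C| * (N' * ((1 + ‖R‖ / a) * K₁) + a⁻¹), d, hd0, ?_⟩
  -- `s / 4` keeps `1 / Λ` above `s / 2`, and `δ / 2` puts it within `δ` of `s`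
  have hev1 : ∀ᶠ n in atTop, ‖(1 - (W n).starProjection) * T‖ < min (δ / 2) (s / 4) :=
    hε.eventually_lt_const (by positivity)
  have hev2 : ∀ᶠ n in atTop, ‖R‖ * (K₁ * (μ n ^ (-σ) * d n)) < 1 / 2 :=
    hlim.eventually_lt_const (by norm_num)
  filter_upwards [hev1, hev2, eventually_gt_atTop j] with n hn1 hn2 hjn
  obtain ⟨hn1a, hn1b⟩ := lt_min_iff.1 hn1
  have hgal := (hr n).isGalerkinSystem hA
  set x := r n j
  set p : H := ∑ k ∈ F, (inner ℂ (b k) x : ℂ) • b k with hp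
  have hup : (Λ n j)⁻¹ ≤ s := hgal.inv_le b htanti hbT ⟨j, hjn⟩
  have hlow : s - 2 * ‖(1 - (W n).starProjection) * T‖ ≤ (Λ n j)⁻¹ :=
    hgal.sub_le_inv hsymm b htanti hbT ⟨j, hjn⟩
  have hΛ : 0 < Λ n j := hgal.pos ⟨j, hjn⟩
  have hxW : x ∈ W n := hgal.mem ⟨j, hjn⟩
  have hxn : ‖x‖ ≤ √(2 / s) := by
    refine Real.le_sqrt_of_sq_le ?_
    have h1 : ‖x‖ ^ 2 = Λ n j := hgal.norm_sq ⟨j, hjn⟩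
    rw [h1, ← inv_inv (Λ n j), ← inv_div]
    exact inv_anti₀ (by positivity) (by linarith)
  have hFlam : ∀ k ∈ F, lam k = lam j := fun k hk => inv_injective (Finset.mem_filter.1 hk).2
  have hTp : T p = (s : ℂ) • p := by
    rw [hp, map_sum, Finset.smul_sum]
    refine Finset.sum_congr rfl fun k hk => ?_
    rw [map_smul, hbu, hTdef, hu.inverse_apply hA, hFlam k hk, smul_comm]
  have hpeig : InEigenspace A (lam j) p := (hA.inEigenspace_iff (hlam j).ne' p).2 hTp
  have herr : ‖x - p‖ ≤ K₁ * (μ n ^ (-σ) * d n) := by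
    have h1 := norm_sub_eigencomponent_le (W := W n) b hbT (F := F) (s := s) (θ := (Λ n j)⁻¹)
      (δ := δ) (x := x) (hgal.projection_apply ⟨j, hjn⟩) hs0.le hδ0 hTp hδ
      (by rw [abs_le]; constructor <;> linarith) (by linarith)
    refine h1.trans ?_
    rw [hK₁, mul_assoc (2 * s / δ)]
    refine mul_le_mul_of_nonneg_left ?_ (by positivity)
    rw [mul_assoc]
    exact mul_le_mul hxn (happrox n) (Finset.sum_nonneg fun _ _ => norm_nonneg _)
      (Real.sqrt_nonneg _)
  have hRx : ‖R x‖ = 1 := by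
    have h1 : inner ℂ (R x) (R x) = (1 : ℂ) := by
      rw [hR, inner_rpow_left, ← rpow_add_apply hT (by norm_num) (by norm_num), add_halves,
        CFC.rpow_one _ hT]
      simpa using hgal.orthonormal ⟨j, hjn⟩ ⟨j, hjn⟩
    rw [inner_self_eq_norm_sq_to_K, ← RCLike.ofReal_pow] at h1
    have h2 : ‖R x‖ ^ 2 = 1 := Complex.ofReal_injective (h1.trans Complex.ofReal_one.symm)
    exact (pow_eq_one_iff_of_nonneg (norm_nonneg _) two_ne_zero).1 h2
  have hRp : ‖R p‖ = a * ‖p‖ := hpeig.norm_rpow_half hA (hlam j)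
  have hsmall : ‖R‖ * ‖x - p‖ ≤ 1 / 2 :=
    (mul_le_mul_of_nonneg_left herr (norm_nonneg _)).trans hn2.le
  obtain ⟨hRp0, hvx⟩ := norm_normalize_sub_le ha0 hRx hRp hsmall
  set v : H := ((‖R p‖⁻¹ : ℝ) : ℂ) • p with hv
  have hveig : InEigenspace A (lam j) v := hpeig.smul _
  have hRv : ‖R v‖ = 1 := by
    rw [hv, map_smul, norm_smul, Complex.norm_real, Real.norm_eq_abs,
      abs_of_pos (inv_pos.2 hRp0), inv_mul_cancel₀ hRp0.ne']
  have hvn : ‖v‖ = a⁻¹ := by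
    have h1 : ‖R v‖ = a * ‖v‖ := hveig.norm_rpow_half hA (hlam j)
    rw [hRv] at h1
    exact eq_inv_of_mul_eq_one_right h1.symm
  refine ⟨v, hveig, by rw [scaleNorm_neg_half]; exact hRv, ?_⟩
  set c : ℕ → ℂ := fun k => ((‖R p‖⁻¹ : ℝ) : ℂ) * inner ℂ (b k) x with hc
  have hvsum : v = ∑ k ∈ F, c k • u k := by
    rw [hv]
    conv_lhs => rw [hp, Finset.smul_sum]
    exact Finset.sum_congr rfl fun k _ => by rw [← hbu k]; exact smul_smul _ _ _
  have hcn : ∀ k ∈ F, ‖c k‖ ≤ a⁻¹ := by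
    intro k hk
    have h1 : inner ℂ (u k) v = c k := by
      rw [hvsum, hu.orthonormal.inner_right_sum c hk]
    rw [← h1, ← hvn]
    exact (norm_inner_le_norm _ _).trans (by rw [hu.orthonormal.1 k, one_mul])
  have hvy : ι.symm v = ((boundedInverse M) ^ σ : G →L[ℂ] G) (∑ k ∈ F, c k • y k) := by
    rw [hvsum, map_sum, map_sum]
    refine Finset.sum_congr rfl fun k hk => ?_
    rw [map_smul, map_smul, hy k (Finset.mem_range.1 (Finset.mem_filter.1 hk).1)]
  have hmem : v - x ∈ (fracPow A τ).domain :=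
    (fracPow A τ).domain.sub_mem (hveig.mem_domain hA (hlam j) hτ)
      (mem_domain_of_mem_trialSpace ι hM hq hτ ⟨C, hC⟩ hxW)
  refine (scaleNorm_sub_le ι hM hMc hq hτ hσ hAM hC hmem hxW hvy).trans ?_
  have htail := norm_sum_sub_fourierSum_le q n F hcn y
  have hpow : μ n ^ τ * μ n ^ (-σ) = μ n ^ (τ - σ) := by
    rw [← Real.rpow_add (hμ n), sub_eq_add_neg]
  have hp1 := Real.rpow_nonneg (hμ n).le τ
  have hp2 := Real.rpow_nonneg (hμ n).le (τ - σ)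
  have hvx' : ‖v - x‖ ≤ (1 + ‖R‖ / a) * (K₁ * (μ n ^ (-σ) * d n)) :=
    hvx.trans (mul_le_mul_of_nonneg_left herr (by positivity))
  calc |C| * (μ n ^ τ * (N' * ‖v - x‖) + μ n ^ (τ - σ) *
        ‖∑ k ∈ F, c k • y k - fourierSum q n (∑ k ∈ F, c k • y k)‖)
      ≤ |C| * (μ n ^ τ * (N' * ((1 + ‖R‖ / a) * (K₁ * (μ n ^ (-σ) * d n)))) +
        μ n ^ (τ - σ) * (a⁻¹ * d n)) := by gcongr
    _ = |C| * (N' * ((1 + ‖R‖ / a) * K₁) + a⁻¹) * (d n * μ n ^ (τ - σ)) := by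
      rw [← hpow]; ring

end Convergence

end FractionalRitz

end

theorem theorem4p4
    {H : Type*} [NormedAddCommGroup H] [InnerProductSpace ℂ H] [CompleteSpace H]
    {G : Type*} [NormedAddCommGroup G] [InnerProductSpace ℂ G] [CompleteSpace G]
    -- `G` has the same elements as `H`, with an equivalent norm
    (ι : G ≃L[ℂ] H)
    (A : H →ₗ.[ℂ] H) (hA : FractionalRitz.IsPosDefSelfAdjoint A)
    (lam : ℕ → ℝ) (u : ℕ → H) (hu : FractionalRitz.IsEigenEnumeration A lam u)
    (M : G →ₗ.[ℂ] G) (hM : FractionalRitz.IsPosDefSelfAdjoint M)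
    (hMc : IsCompactOperator (FractionalRitz.boundedInverse M))
    (μ : ℕ → ℝ) (q : ℕ → G) (hq : FractionalRitz.IsEigenEnumeration M μ q)
    -- the dual harmonic Ritz values and vectors with trial vectors `q 0, …, q (n - 1)`
    (Λ : ℕ → ℕ → ℝ) (r : ℕ → ℕ → H)
    (hr : ∀ n : ℕ, FractionalRitz.IsRitzSystem A 0 (fun k => ι (q k)) n
      (fun i => Λ n i) (fun i => r n i))
    (τ : ℝ) (hτ : 0 < τ)
    -- `D(M^τ) = D(A^τ)` with equivalent norms
    (hMA : FractionalRitz.ContinuouslyContained M A ι τ)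
    (hAM : FractionalRitz.ContinuouslyContained A M ι.symm τ)
    -- `D(M^{2τ})` is continuously contained in `D(A^{2τ})`
    (hMA2 : FractionalRitz.ContinuouslyContained M A ι (2 * τ))
    (ℓ : ℕ)
    -- the span of `u 0, …, u (ℓ - 1)` is a sum of full eigenspaces of `A`
    (hgap : ∀ j < ℓ, lam j < lam ℓ)
    (hratio : ∀ j < ℓ, ∃ C : ℝ≥0, ∀ᶠ n in atTop,
      FractionalRitz.weightedTail μ q (4 * τ) (ι.symm (u j)) n /
          FractionalRitz.weightedTail μ q (2 * τ) (ι.symm (u j)) n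
        ≤ C * ENNReal.ofReal (μ n ^ (2 * τ)))
    (σ : ℝ) (hσ : τ ≤ σ)
    (hsmooth : ∀ j < ℓ, ι.symm (u j) ∈ (FractionalRitz.fracPow M σ).domain) :
    ∀ j < ℓ,
      -- approximation by eigenvectors normalized in the norm of index `-1/2`
      (∃ v : ℕ → H,
        (∀ n, FractionalRitz.InEigenspace A (lam j) (v n) ∧
          FractionalRitz.scaleNorm A (-1 / 2) (v n) = 1) ∧
        (∀ n, j < n → v n - r n j ∈ (FractionalRitz.fracPow A τ).domain) ∧
        (fun n => FractionalRitz.scaleNorm A τ (v n - r n j))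
          =o[atTop] fun n => μ n ^ (τ - σ)) ∧
      -- for a simple eigenvalue: the fixed eigenvector `u j`, rescaled to be normalized in the
      -- norm of index `-1/2`, and Ritz vectors up to phase
      ((∀ i, lam i = lam j → i = j) →
        ∃ ω : ℕ → ℂ, (∀ n, ‖ω n‖ = 1) ∧
          (∀ n, j < n →
            ((√(lam j) : ℝ) : ℂ) • u j - ω n • r n j ∈ (FractionalRitz.fracPow A τ).domain) ∧
          (fun n => FractionalRitz.scaleNorm A τ (((√(lam j) : ℝ) : ℂ) • u j - ω n • r n j))
            =o[atTop] fun n => μ n ^ (τ - σ)) := by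
  intro j hj
  have hlam := hu.pos hA
  have hmem : ∀ n, j < n → ∀ x, FractionalRitz.InEigenspace A (lam j) x →
      x - r n j ∈ (FractionalRitz.fracPow A τ).domain := fun n hn x hx =>
    (FractionalRitz.fracPow A τ).domain.sub_mem (hx.mem_domain hA (hlam j) hτ)
      (FractionalRitz.mem_domain_of_mem_trialSpace ι hM hq hτ hMA
        (((hr n).isGalerkinSystem hA).mem ⟨j, hn⟩))
  obtain ⟨K, d, hd, hev⟩ := FractionalRitz.exists_eigenvector_scaleNorm_sub_le ι hA hu hM hMc hq hr
    hτ hσ hMA hAM (hgap j hj) hsmooth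
  have hsq : 0 < √(lam j) := Real.sqrt_pos.2 (hlam j)
  -- for the finitely many `n` outside the estimate, any normalized eigenvector will do
  have hex : ∀ n, ∃ v : H, (FractionalRitz.InEigenspace A (lam j) v ∧
      FractionalRitz.scaleNorm A (-1 / 2) v = 1) ∧
      ((∃ v' : H, FractionalRitz.InEigenspace A (lam j) v' ∧
        FractionalRitz.scaleNorm A (-1 / 2) v' = 1 ∧
        FractionalRitz.scaleNorm A τ (v' - r n j) ≤ K * (d n * μ n ^ (τ - σ))) →
        FractionalRitz.scaleNorm A τ (v - r n j) ≤ K * (d n * μ n ^ (τ - σ))) := by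
    intro n
    by_cases h : ∃ v' : H, FractionalRitz.InEigenspace A (lam j) v' ∧
        FractionalRitz.scaleNorm A (-1 / 2) v' = 1 ∧
        FractionalRitz.scaleNorm A τ (v' - r n j) ≤ K * (d n * μ n ^ (τ - σ))
    · obtain ⟨v', h1, h2, h3⟩ := h
      exact ⟨v', ⟨h1, h2⟩, fun _ => h3⟩
    · refine ⟨((√(lam j) : ℝ) : ℂ) • u j, ⟨(hu.eigen j).smul _, ?_⟩, fun h' => absurd h' h⟩
      rw [FractionalRitz.scaleNorm_neg_half, ((hu.eigen j).smul _).norm_rpow_half hA (hlam j),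
        norm_smul, Complex.norm_real, Real.norm_eq_abs, abs_of_pos hsq, hu.orthonormal.1 j,
        mul_one, inv_mul_cancel₀ hsq.ne']
  choose v hv hvb using hex
  have hsmall : (fun n => FractionalRitz.scaleNorm A τ (v n - r n j))
      =o[atTop] fun n => μ n ^ (τ - σ) := by
    have h1 : (fun n => FractionalRitz.scaleNorm A τ (v n - r n j))
        =O[atTop] fun n => d n * μ n ^ (τ - σ) := by
      refine IsBigO.of_bound |K| ?_
      filter_upwards [hev] with n hn
      rw [Real.norm_eq_abs, abs_of_nonneg (FractionalRitz.scaleNorm_nonneg _ _), Real.norm_eq_abs,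
        ← abs_mul]
      exact (hvb n hn).trans (le_abs_self _)
    have h2 : (fun n => d n * μ n ^ (τ - σ)) =o[atTop] fun n => (1 : ℝ) * μ n ^ (τ - σ) :=
      ((isLittleO_one_iff ℝ).2 hd).mul_isBigO (isBigO_refl _ _)
    simpa using h1.trans_isLittleO h2
  refine ⟨⟨v, hv, fun n hn => hmem n hn _ (hv n).1, hsmall⟩, fun hsimple => ?_⟩
  -- for a simple eigenvalue, `v n` is a multiple of `u j`, whose phase is moved to the Ritz vector
  have hspan : ∀ n, ∃ c : ℂ, c • u j = v n := by
    intro n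
    have h1 := hu.exhaustive _ _ (hv n).1
    have h2 : {k | lam k = lam j} = {j} := by
      ext k
      exact ⟨fun hk => hsimple k hk, fun hk => by rw [Set.mem_singleton_iff.1 hk]; rfl⟩
    rw [h2, Set.image_singleton] at h1
    exact Submodule.mem_span_singleton.1 h1
  choose c hc using hspan
  have hcn : ∀ n, ‖c n‖ = √(lam j) := by
    intro n
    have h1 := (hv n).2
    rw [FractionalRitz.scaleNorm_neg_half, (hv n).1.norm_rpow_half hA (hlam j), ← hc n, norm_smul,
      hu.orthonormal.1 j, mul_one, inv_mul_eq_one₀ hsq.ne'] at h1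
    exact h1.symm
  have hc0 : ∀ n, c n ≠ 0 := fun n => norm_ne_zero_iff.1 (by rw [hcn n]; exact hsq.ne')
  set ω : ℕ → ℂ := fun n => ((√(lam j) : ℝ) : ℂ) / c n with hω
  have hωn : ∀ n, ‖ω n‖ = 1 := by
    intro n
    rw [hω]
    simp only
    rw [norm_div, hcn n, Complex.norm_real, Real.norm_eq_abs, abs_of_pos hsq, div_self hsq.ne']
  have hωv : ∀ n, ((√(lam j) : ℝ) : ℂ) • u j - ω n • r n j = ω n • (v n - r n j) := by
    intro n
    rw [smul_sub, ← hc n, smul_smul, hω]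
    simp only
    rw [div_mul_cancel₀ _ (hc0 n)]
  refine ⟨ω, hωn, fun n hn => ?_, ?_⟩
  · rw [hωv n]
    exact (FractionalRitz.fracPow A τ).domain.smul_mem _ (hmem n hn _ (hv n).1)
  · refine hsmall.congr' ?_ EventuallyEq.rfl
    filter_upwards [eventually_gt_atTop j] with n hn
    rw [hωv n, FractionalRitz.scaleNorm_smul _ _ _ (hmem n hn _ (hv n).1), hωn n, one_mul]
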